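/- **Setting.** Let $G/K$ be an irreducible Riemannian globally symmetric space of non-compact type III whose group $G$ is classical, that is, one of the following, with Cartan involution $\theta g=(g^{*})^{-1}$, $G$ connected, and $K=\{g\in G:\theta g=g\}$ (compact): - $AI$: $G=SL(n,\mathbb R)$, $n\ge 2$; - $AII$: $G=SL(n,\mathbb H)$, $n\ge 2$; - $AIII$: $G=SU(p,q)$, $1\le p\le q$; - $BI/DI$: $G=SO_0(p,q)$, $1\le p\le q$, with $p\ge 3$ if $p=q$; - $CI$: $G=Sp(n,\mathbb R)$, $n\ge 1$; - $CII$: $G=Sp(p,q)$, $1\le p\le q$; - $DIII$: $G=SO^{*}(2n)$, $n\ge 3$. Let $\mathfrak g=\mathfrak k\oplus\mathfrak p$ be the Cartan decomposition and let $\mathfrak a\subset\mathfrak p$ be the standard maximal abelian subspace. Quaternionic matrices are written as complex matrices of twice the size. The elements of $\mathfrak a$ are described by a real coordinate vector $x$, in terms of which the restricted roots are the usual ones: - $AI$: $\mathrm{diag}(x_1,\dots,x_n)$ with $\sum_j x_j=0$; $AII$: the same real diagonal matrix over $\mathbb H$. The restricted root system is of type $A_{n-1}$. - $AIII$, $BI/DI$,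 $CII$: $\begin{bmatrix}0&Z\\ Z^{t}&0\end{bmatrix}$, where $Z$ is the $p\times q$ matrix with diagonal entries $x_1,\dots,x_p$ and zeros elsewhere (over $\mathbb C$, $\mathbb R$, $\mathbb H$ respectively). For $AIII$ and $CII$ the type is $C_p$ if $p=q$ and $BC_p$ if $p<q$; for $BI/DI$ it is $D_p$ if $p=q$ and $B_p$ if $p<q$. - $CI$: $\mathrm{diag}(x_1,\dots,x_n,-x_1,\dots,-x_n)$, type $C_n$. - $DIII$: $\begin{bmatrix}H&0\\0&-H\end{bmatrix}$ with $H$ block diagonal with blocks $\begin{bmatrix}0&i x_k\\-i x_k&0\end{bmatrix}$, $1\le k\le m=\lfloor n/2\rfloor$, and one further zero entry if $n$ is odd; type $C_m$ if $n$ is even and $BC_m$ if $n$ is odd. For $X\in\mathfrak p$ the orbital measure $\mu_X$ is the probability measure on $\mathfrak p$ given by $\int f\,d\mu_X=\int_K f(\mathrm{Ad}(k)X)\,dm_K(k)$, where $m_K$ is the normalized Haar measure of $K$ and $\mathrm{Ad}(k)X=kXk^{-1}$. **Eligibility.** Let $X\in\mathfrak a$ have coordinate vector $x$. In type $A_{n-1}$,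 $S_X$ is the largest number of equal coordinates of $x\in\mathbb R^n$. In types $B_r,C_r,D_r,BC_r$, let $J$ be the number of zero coordinates of $x\in\mathbb R^r$ and let $s$ be the largest number of non-zero coordinates having the same absolute value ($s=0$ if $x=0$); put $S_X=2J$ if $2J\ge s$ and $S_X=s$ otherwise. A tuple $(X_1,\dots,X_L)\in\mathfrak a^L$ is *eligible* if $\sum_{i=1}^L S_{X_i}\le (L-1)N$, where $N=n$ in type $A_{n-1}$ and $N=2r$ in types $B_r,C_r,D_r,BC_r$. **Proposition.** Let $L\ge 1$. If $(X_1,\dots,X_L)\in\mathfrak a^L$ is not eligible, then $\mu_{X_1}*\cdots*\mu_{X_L}$ is singular with respect to Lebesgue measure on $\mathfrak p$. -/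

import Mathlib

open MeasureTheory Matrix Topology

/-! ### Real linear groups inside `GL(ι, ℂ)`, cut out by forms and real structures -/

/-- Data cutting out a real form of a complex classical group: matrices of bilinear forms and of
sesquilinear forms that have to be preserved, and matrices `C` of antilinear maps `v ↦ C v̄` that
have to be commuted with. -/
structure FormData (ι : Type) where
  bil : Set (Matrix ι ι ℂ)
  herm : Set (Matrix ι ι ℂ)
  real : Set (Matrix ι ι ℂ)

namespace FormData

variable {ι : Type} [Fintype ι] [DecidableEq ι]

/-- The group of all complex matrices of determinant one that preserve all the forms and commute
with all the real structures. -/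
noncomputable def fullGroup (D : FormData ι) : Subgroup (GL ι ℂ) where
  carrier := {g | (g : Matrix ι ι ℂ).det = 1 ∧
    (∀ S ∈ D.bil, (g : Matrix ι ι ℂ)ᵀ * S * (g : Matrix ι ι ℂ) = S) ∧
    (∀ H ∈ D.herm, (g : Matrix ι ι ℂ)ᴴ * H * (g : Matrix ι ι ℂ) = H) ∧
    (∀ C ∈ D.real, (g : Matrix ι ι ℂ) * C = C * (g : Matrix ι ι ℂ).map star)}
  one_mem' := by
    refine ⟨by simp, fun S _ => by simp, fun H _ => by simp, fun C _ => by simp⟩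
  mul_mem' := by
    rintro a b ⟨ha, ha1, ha2, ha3⟩ ⟨hb, hb1, hb2, hb3⟩
    refine ⟨by simp [ha, hb], fun S hS => ?_, fun H hH => ?_, fun C hC => ?_⟩
    · calc _ = (b : Matrix ι ι ℂ)ᵀ * ((a : Matrix ι ι ℂ)ᵀ * S * a) * b := by
            simp [Matrix.mul_assoc]
        _ = S := by rw [ha1 S hS, hb1 S hS]
    · calc _ = (b : Matrix ι ι ℂ)ᴴ * ((a : Matrix ι ι ℂ)ᴴ * H * a) * b := by
            simp [Matrix.mul_assoc]
        _ = H := by rw [ha2 H hH, hb2 H hH]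
    · have hm : ((a * b : GL ι ℂ) : Matrix ι ι ℂ).map star
          = (a : Matrix ι ι ℂ).map star * (b : Matrix ι ι ℂ).map star :=
        Matrix.map_mul (f := starRingEnd ℂ)
      rw [hm, Units.val_mul, Matrix.mul_assoc, hb3 C hC, ← Matrix.mul_assoc, ha3 C hC,
        Matrix.mul_assoc]
  inv_mem' := by
    rintro a ⟨ha, ha1, ha2, ha3⟩
    have hi : (a : Matrix ι ι ℂ) * ((a⁻¹ : GL ι ℂ) : Matrix ι ι ℂ) = 1 := a.mul_inv
    have hi' : ((a⁻¹ : GL ι ℂ) : Matrix ι ι ℂ) * (a : Matrix ι ι ℂ) = 1 := a.inv_mul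
    refine ⟨?_, fun S hS => ?_, fun H hH => ?_, fun C hC => ?_⟩
    · have := congrArg Matrix.det hi
      rwa [Matrix.det_mul, ha, one_mul, Matrix.det_one] at this
    · have ht : ((a⁻¹ : GL ι ℂ) : Matrix ι ι ℂ)ᵀ * (a : Matrix ι ι ℂ)ᵀ = 1 := by
        rw [← Matrix.transpose_mul, hi, Matrix.transpose_one]
      conv_lhs => rw [← ha1 S hS]
      calc _ = (((a⁻¹ : GL ι ℂ) : Matrix ι ι ℂ)ᵀ * (a : Matrix ι ι ℂ)ᵀ) * S *
            ((a : Matrix ι ι ℂ) * ((a⁻¹ : GL ι ℂ) : Matrix ι ι ℂ)) := by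
            simp only [Matrix.mul_assoc]
        _ = S := by rw [ht, hi, Matrix.one_mul, Matrix.mul_one]
    · have ht : ((a⁻¹ : GL ι ℂ) : Matrix ι ι ℂ)ᴴ * (a : Matrix ι ι ℂ)ᴴ = 1 := by
        rw [← Matrix.conjTranspose_mul, hi, Matrix.conjTranspose_one]
      conv_lhs => rw [← ha2 H hH]
      calc _ = (((a⁻¹ : GL ι ℂ) : Matrix ι ι ℂ)ᴴ * (a : Matrix ι ι ℂ)ᴴ) * H *
            ((a : Matrix ι ι ℂ) * ((a⁻¹ : GL ι ℂ) : Matrix ι ι ℂ)) := by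
            simp only [Matrix.mul_assoc]
        _ = H := by rw [ht, hi, Matrix.one_mul, Matrix.mul_one]
    · have hm : (a : Matrix ι ι ℂ).map star * ((a⁻¹ : GL ι ℂ) : Matrix ι ι ℂ).map star = 1 := by
        have h : ((a : Matrix ι ι ℂ) * ((a⁻¹ : GL ι ℂ) : Matrix ι ι ℂ)).map star
            = (a : Matrix ι ι ℂ).map star * ((a⁻¹ : GL ι ℂ) : Matrix ι ι ℂ).map star :=
          Matrix.map_mul (f := starRingEnd ℂ)
        rw [← h, hi]
        simp
      calc ((a⁻¹ : GL ι ℂ) : Matrix ι ι ℂ) * C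
          = ((a⁻¹ : GL ι ℂ) : Matrix ι ι ℂ) * (C * ((a : Matrix ι ι ℂ).map star
              * ((a⁻¹ : GL ι ℂ) : Matrix ι ι ℂ).map star)) := by rw [hm, Matrix.mul_one]
        _ = ((a⁻¹ : GL ι ℂ) : Matrix ι ι ℂ) * ((C * (a : Matrix ι ι ℂ).map star)
              * ((a⁻¹ : GL ι ℂ) : Matrix ι ι ℂ).map star) := by rw [Matrix.mul_assoc C]
        _ = (((a⁻¹ : GL ι ℂ) : Matrix ι ι ℂ) * (a : Matrix ι ι ℂ)) * C
              * ((a⁻¹ : GL ι ℂ) : Matrix ι ι ℂ).map star := by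
            rw [← ha3 C hC]; simp only [Matrix.mul_assoc]
        _ = _ := by rw [hi', Matrix.one_mul]

/-- The connected Lie group `G`: the identity component of `fullGroup`. -/
noncomputable def G (D : FormData ι) : Subgroup (GL ι ℂ) :=
  (Subgroup.connectedComponentOfOne D.fullGroup).map D.fullGroup.subtype

/-- `K = {g ∈ G : θ g = g}` for the Cartan involution `θ g = (gᴴ)⁻¹`; the condition `θ g = g` is
written as `gᴴ * g = 1`. -/
noncomputable def K (D : FormData ι) : Subgroup (GL ι ℂ) where
  carrier := {g | g ∈ D.G ∧ (g : Matrix ι ι ℂ)ᴴ * (g : Matrix ι ι ℂ) = 1}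
  one_mem' := ⟨D.G.one_mem, by simp⟩
  mul_mem' := by
    rintro a b ⟨ha, ha'⟩ ⟨hb, hb'⟩
    refine ⟨D.G.mul_mem ha hb, ?_⟩
    calc _ = (b : Matrix ι ι ℂ)ᴴ * ((a : Matrix ι ι ℂ)ᴴ * a) * b := by simp [Matrix.mul_assoc]
      _ = 1 := by rw [ha', Matrix.mul_one, hb']
  inv_mem' := by
    rintro a ⟨ha, ha'⟩
    refine ⟨D.G.inv_mem ha, ?_⟩
    have hi : (a : Matrix ι ι ℂ) * ((a⁻¹ : GL ι ℂ) : Matrix ι ι ℂ) = 1 := a.mul_inv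
    have h : (a : Matrix ι ι ℂ)ᴴ = ((a⁻¹ : GL ι ℂ) : Matrix ι ι ℂ) := by
      rw [← Matrix.mul_one (a : Matrix ι ι ℂ)ᴴ, ← hi, ← Matrix.mul_assoc, ha', Matrix.one_mul]
    rw [← h, Matrix.conjTranspose_conjTranspose, h, hi]

/-- The Lie algebra `𝔤` of `G`. -/
noncomputable def 𝔤 (D : FormData ι) : Submodule ℝ (Matrix ι ι ℂ) where
  carrier := {X | X.trace = 0 ∧ (∀ S ∈ D.bil, Xᵀ * S + S * X = 0) ∧
    (∀ H ∈ D.herm, Xᴴ * H + H * X = 0) ∧ (∀ C ∈ D.real, X * C = C * X.map star)}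
  zero_mem' := by
    refine ⟨by simp, fun S _ => by simp, fun H _ => by simp, fun C _ => ?_⟩
    have : (0 : Matrix ι ι ℂ).map star = 0 := by ext; simp
    rw [this]; simp
  add_mem' := by
    rintro X Y ⟨h0, h1, h2, h3⟩ ⟨k0, k1, k2, k3⟩
    refine ⟨by simp [h0, k0], fun S hS => ?_, fun H hH => ?_, fun C hC => ?_⟩
    · calc (X + Y)ᵀ * S + S * (X + Y) = (Xᵀ * S + S * X) + (Yᵀ * S + S * Y) := by
            simp only [Matrix.transpose_add, Matrix.add_mul, Matrix.mul_add]; abel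
        _ = 0 := by rw [h1 S hS, k1 S hS, add_zero]
    · calc (X + Y)ᴴ * H + H * (X + Y) = (Xᴴ * H + H * X) + (Yᴴ * H + H * Y) := by
            simp only [Matrix.conjTranspose_add, Matrix.add_mul, Matrix.mul_add]; abel
        _ = 0 := by rw [h2 H hH, k2 H hH, add_zero]
    · have : (X + Y).map star = X.map star + Y.map star := by ext; simp
      rw [this, Matrix.add_mul, Matrix.mul_add, h3 C hC, k3 C hC]
  smul_mem' := by
    rintro c X ⟨h0, h1, h2, h3⟩
    refine ⟨by simp [h0], fun S hS => ?_, fun H hH => ?_, fun C hC => ?_⟩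
    · rw [Matrix.transpose_smul, Matrix.smul_mul, Matrix.mul_smul, ← smul_add, h1 S hS, smul_zero]
    · rw [Matrix.conjTranspose_smul, star_trivial, Matrix.smul_mul, Matrix.mul_smul, ← smul_add,
        h2 H hH, smul_zero]
    · have : (c • X).map star = c • X.map star := by ext; simp
      rw [this, Matrix.smul_mul, Matrix.mul_smul, h3 C hC]

/-- `𝔭 = {X ∈ 𝔤 : θ X = -X}` for the Cartan involution `θ X = -Xᴴ` of `𝔤`. -/
noncomputable def 𝔭 (D : FormData ι) : Submodule ℝ (Matrix ι ι ℂ) where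
  carrier := {X | X ∈ D.𝔤 ∧ Xᴴ = X}
  zero_mem' := ⟨D.𝔤.zero_mem, by simp⟩
  add_mem' := by
    rintro X Y ⟨h, h'⟩ ⟨k, k'⟩
    exact ⟨D.𝔤.add_mem h k, by simp [h', k']⟩
  smul_mem' := by
    rintro c X ⟨h, h'⟩
    exact ⟨D.𝔤.smul_mem c h, by simp [h']⟩

lemma mem_fullGroup_of_mem_K {D : FormData ι} {k : GL ι ℂ} (hk : k ∈ D.K) : k ∈ D.fullGroup := by
  obtain ⟨⟨g, -, rfl⟩, -⟩ := hk
  exact g.2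

lemma Ad_mem {D : FormData ι} {k : GL ι ℂ} (hk : k ∈ D.K) {X : Matrix ι ι ℂ} (hX : X ∈ D.𝔭) :
    (k : Matrix ι ι ℂ) * X * ((k⁻¹ : GL ι ℂ) : Matrix ι ι ℂ) ∈ D.𝔭 := by
  obtain ⟨-, a1, a2, a3⟩ := mem_fullGroup_of_mem_K hk
  obtain ⟨-, b1, b2, b3⟩ := mem_fullGroup_of_mem_K (D.K.inv_mem hk)
  have hu := hk.2
  obtain ⟨⟨h0, h1, h2, h3⟩, hX'⟩ := hX
  have hi : (k : Matrix ι ι ℂ) * ((k⁻¹ : GL ι ℂ) : Matrix ι ι ℂ) = 1 := k.mul_inv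
  have hi' : ((k⁻¹ : GL ι ℂ) : Matrix ι ι ℂ) * (k : Matrix ι ι ℂ) = 1 := k.inv_mul
  have hs : (k : Matrix ι ι ℂ)ᴴ = ((k⁻¹ : GL ι ℂ) : Matrix ι ι ℂ) := by
    rw [← Matrix.mul_one (k : Matrix ι ι ℂ)ᴴ, ← hi, ← Matrix.mul_assoc, hu, Matrix.one_mul]
  have hs' : ((k⁻¹ : GL ι ℂ) : Matrix ι ι ℂ)ᴴ = (k : Matrix ι ι ℂ) := by
    rw [← hs, Matrix.conjTranspose_conjTranspose]
  generalize ((k⁻¹ : GL ι ℂ) : Matrix ι ι ℂ) = l at *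
  generalize (k : Matrix ι ι ℂ) = k at *
  refine ⟨⟨?_, fun S hS => ?_, fun H hH => ?_, fun C hC => ?_⟩, ?_⟩
  · rw [Matrix.trace_mul_comm, ← Matrix.mul_assoc, hi', Matrix.one_mul, h0]
  · have e1 : kᵀ * S = S * l := by
      rw [← Matrix.mul_one (kᵀ * S), ← hi, ← Matrix.mul_assoc, a1 S hS]
    have e2 : lᵀ * S = S * k := by
      rw [← Matrix.mul_one (lᵀ * S), ← hi', ← Matrix.mul_assoc, b1 S hS]
    calc (k * X * l)ᵀ * S + S * (k * X * l)
        = lᵀ * Xᵀ * (kᵀ * S) + (S * k) * X * l := by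
          simp only [Matrix.transpose_mul, Matrix.mul_assoc]
      _ = lᵀ * (Xᵀ * S + S * X) * l := by
          rw [e1, ← e2]; simp only [Matrix.mul_add, Matrix.add_mul, Matrix.mul_assoc]
      _ = 0 := by rw [h1 S hS]; simp
  · have e1 : kᴴ * H = H * l := by
      rw [← Matrix.mul_one (kᴴ * H), ← hi, ← Matrix.mul_assoc, a2 H hH]
    have e2 : lᴴ * H = H * k := by
      rw [← Matrix.mul_one (lᴴ * H), ← hi', ← Matrix.mul_assoc, b2 H hH]
    calc (k * X * l)ᴴ * H + H * (k * X * l)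
        = lᴴ * Xᴴ * (kᴴ * H) + (H * k) * X * l := by
          simp only [Matrix.conjTranspose_mul, Matrix.mul_assoc]
      _ = lᴴ * (Xᴴ * H + H * X) * l := by
          rw [e1, ← e2]; simp only [Matrix.mul_add, Matrix.add_mul, Matrix.mul_assoc]
      _ = 0 := by rw [h2 H hH]; simp
  · have hm : (k * X * l).map star = k.map star * X.map star * l.map star := by
      have h (A B : Matrix ι ι ℂ) : (A * B).map star = A.map star * B.map star :=
        Matrix.map_mul (f := starRingEnd ℂ)
      rw [h, h]
    calc k * X * l * C = k * (X * (l * C)) := by simp only [Matrix.mul_assoc]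
      _ = (k * C) * X.map star * l.map star := by
          rw [b3 C hC, ← Matrix.mul_assoc X, h3 C hC]; simp only [Matrix.mul_assoc]
      _ = C * (k * X * l).map star := by
          rw [a3 C hC, hm]; simp only [Matrix.mul_assoc]
  · rw [Matrix.conjTranspose_mul, Matrix.conjTranspose_mul, hs, hs', hX', Matrix.mul_assoc]

/-- The adjoint action `Ad(k) X = k X k⁻¹` of `K` on `𝔭`. -/
noncomputable def Ad (D : FormData ι) (k : D.K) (X : D.𝔭) : D.𝔭 :=
  ⟨((k : GL ι ℂ) : Matrix ι ι ℂ) * (X : Matrix ι ι ℂ) * (((k : GL ι ℂ)⁻¹ : GL ι ℂ) : Matrix ι ι ℂ),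
    Ad_mem k.2 X.2⟩

/-! ### Haar measure on `K`, Lebesgue measure on `𝔭`, orbital measures -/

lemma isClosed_fullGroup (D : FormData ι) : IsClosed (D.fullGroup : Set (GL ι ℂ)) := by
  have hc : Continuous (fun g : GL ι ℂ => (g : Matrix ι ι ℂ)) := Units.continuous_val
  have : (D.fullGroup : Set (GL ι ℂ)) = {g : GL ι ℂ | (g : Matrix ι ι ℂ).det = 1} ∩
      ((⋂ S ∈ D.bil, {g : GL ι ℂ | (g : Matrix ι ι ℂ)ᵀ * S * (g : Matrix ι ι ℂ) = S}) ∩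
      ((⋂ H ∈ D.herm, {g : GL ι ℂ | (g : Matrix ι ι ℂ)ᴴ * H * (g : Matrix ι ι ℂ) = H}) ∩
      (⋂ C ∈ D.real, {g : GL ι ℂ | (g : Matrix ι ι ℂ) * C = C * (g : Matrix ι ι ℂ).map star}))) := by
    ext g
    simp only [Set.mem_inter_iff, Set.mem_iInter, Set.mem_ofPred_eq]
    rfl
  rw [this]
  refine (isClosed_eq (by fun_prop) continuous_const).inter (.inter ?_ (.inter ?_ ?_))
  · exact isClosed_biInter fun S _ => isClosed_eq (by fun_prop) continuous_const
  · exact isClosed_biInter fun S _ => isClosed_eq (by fun_prop) continuous_const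
  · exact isClosed_biInter fun S _ =>
      isClosed_eq (by fun_prop) (continuous_const.mul (hc.matrix_map continuous_star))

lemma isClosed_G (D : FormData ι) : IsClosed (D.G : Set (GL ι ℂ)) := by
  have h : (D.G : Set (GL ι ℂ)) = Subtype.val '' connectedComponent (1 : D.fullGroup) := rfl
  rw [h]
  exact D.isClosed_fullGroup.isClosedEmbedding_subtypeVal.isClosedMap _
    isClosed_connectedComponent

lemma isCompact_K (D : FormData ι) : IsCompact (D.K : Set (GL ι ℂ)) := by
  have hc : Continuous (fun g : GL ι ℂ => (g : Matrix ι ι ℂ)) := Units.continuous_val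
  have hU : IsCompact ((Matrix.unitaryGroup ι ℂ : Set (Matrix ι ι ℂ))) := by
    have hbox : IsCompact (Set.pi Set.univ fun _ : ι => Set.pi Set.univ fun _ : ι =>
        Metric.closedBall (0 : ℂ) 1) :=
      isCompact_univ_pi fun _ => isCompact_univ_pi fun _ => isCompact_closedBall _ _
    refine IsCompact.of_isClosed_subset hbox (isClosed_unitary (R := Matrix ι ι ℂ)) ?_
    intro U hU i _ j _
    rw [mem_closedBall_zero_iff]
    exact entry_norm_bound_of_unitary hU i j
  refine IsCompact.of_isClosed_subset (Submonoid.units_isCompact hU) ?_ ?_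
  · exact D.isClosed_G.inter (isClosed_eq (by fun_prop) continuous_const)
  · intro g hg
    have hg' : (g : Matrix ι ι ℂ) ∈ Matrix.unitaryGroup ι ℂ :=
      Matrix.mem_unitaryGroup_iff'.2 hg.2
    have hi : (((g⁻¹ : GL ι ℂ)) : Matrix ι ι ℂ) ∈ Matrix.unitaryGroup ι ℂ :=
      Matrix.mem_unitaryGroup_iff'.2 (D.K.inv_mem hg).2
    exact (Submonoid.mem_units_iff _ _).2 ⟨hg', hi⟩

instance (D : FormData ι) : CompactSpace D.K := isCompact_iff_compactSpace.1 D.isCompact_K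

noncomputable instance (D : FormData ι) : MeasurableSpace D.K := borel _

instance (D : FormData ι) : BorelSpace D.K := ⟨rfl⟩

noncomputable instance (D : FormData ι) : MeasurableSpace D.𝔭 := borel _

instance (D : FormData ι) : BorelSpace D.𝔭 := ⟨rfl⟩

instance (D : FormData ι) : LocallyCompactSpace D.𝔭 :=
  LocallyCompactSpace.of_finiteDimensional_of_complete ℝ D.𝔭

/-- The Haar measure `m_K` of the compact group `K`, normalized by `m_K(K) = 1`. -/
noncomputable def haarK (D : FormData ι) : Measure D.K := Measure.haarMeasure ⊤

/-- Lebesgue measure on the real vector space `𝔭` (unique up to a positive factor). -/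
noncomputable def lebesgue (D : FormData ι) : Measure D.𝔭 := Measure.addHaar

/-- The orbital measure `μ_X`, the image of `m_K` under `k ↦ Ad(k) X`. -/
noncomputable def orbitalMeasure (D : FormData ι) (X : D.𝔭) : Measure D.𝔭 :=
  D.haarK.map fun k => D.Ad k X

/-- The convolution product `μ_{X 0} ∗ ⋯ ∗ μ_{X (L-1)}`. -/
noncomputable def orbitalConvolution (D : FormData ι) {L : ℕ} (X : Fin L → D.𝔭) : Measure D.𝔭 :=
  (List.ofFn fun i => D.orbitalMeasure (X i)).foldr Measure.conv (Measure.dirac 0)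

end FormData

/-! ### The classical symmetric spaces of type III -/

/-- The Cartan classes, with their parameters. `BDI p q` comprises `BI` and `DI`. -/
inductive CartanClass
  | AI (n : ℕ)
  | AII (n : ℕ)
  | AIII (p q : ℕ)
  | BDI (p q : ℕ)
  | CI (n : ℕ)
  | CII (p q : ℕ)
  | DIII (n : ℕ)

/-- The possible types of the restricted root system. -/
inductive RootType
  | A
  | B
  | C
  | D
  | BC

namespace CartanClass

/-- The range of the parameters for which the symmetric space is noncompact and irreducible. -/
def Admissible : CartanClass → Prop
  | AI n => 2 ≤ n
  | AII n => 2 ≤ n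
  | AIII p q => 1 ≤ p ∧ p ≤ q
  | BDI p q => 1 ≤ p ∧ p ≤ q ∧ (p = q → 3 ≤ p)
  | CI n => 1 ≤ n
  | CII p q => 1 ≤ p ∧ p ≤ q
  | DIII n => 3 ≤ n

/-- The index set of the matrices. -/
def Idx : CartanClass → Type
  | AI n => Fin n
  | AII n => Fin n ⊕ Fin n
  | AIII p q => Fin p ⊕ Fin q
  | BDI p q => Fin p ⊕ Fin q
  | CI n => Fin n ⊕ Fin n
  | CII p q => (Fin p ⊕ Fin q) ⊕ (Fin p ⊕ Fin q)
  | DIII n => Fin n ⊕ Fin n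

instance : (c : CartanClass) → Fintype c.Idx
  | AI n => inferInstanceAs (Fintype (Fin n))
  | AII n => inferInstanceAs (Fintype (Fin n ⊕ Fin n))
  | AIII p q => inferInstanceAs (Fintype (Fin p ⊕ Fin q))
  | BDI p q => inferInstanceAs (Fintype (Fin p ⊕ Fin q))
  | CI n => inferInstanceAs (Fintype (Fin n ⊕ Fin n))
  | CII p q => inferInstanceAs (Fintype ((Fin p ⊕ Fin q) ⊕ (Fin p ⊕ Fin q)))
  | DIII n => inferInstanceAs (Fintype (Fin n ⊕ Fin n))

instance : (c : CartanClass) → DecidableEq c.Idx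
  | AI n => inferInstanceAs (DecidableEq (Fin n))
  | AII n => inferInstanceAs (DecidableEq (Fin n ⊕ Fin n))
  | AIII p q => inferInstanceAs (DecidableEq (Fin p ⊕ Fin q))
  | BDI p q => inferInstanceAs (DecidableEq (Fin p ⊕ Fin q))
  | CI n => inferInstanceAs (DecidableEq (Fin n ⊕ Fin n))
  | CII p q => inferInstanceAs (DecidableEq ((Fin p ⊕ Fin q) ⊕ (Fin p ⊕ Fin q)))
  | DIII n => inferInstanceAs (DecidableEq (Fin n ⊕ Fin n))

/-- The matrix `diag(I_p, -I_q)`. -/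
def signature (p q : ℕ) : Matrix (Fin p ⊕ Fin q) (Fin p ⊕ Fin q) ℂ :=
  Matrix.fromBlocks 1 0 0 (-1)

/-- The forms and real structures of each class. The connected groups `G` that they define are:
* `AI`: `SL(n, ℝ)`;
* `AII`: `SL(n, ℍ)`, as the complex `2n × 2n` matrices commuting with the quaternionic structure;
* `AIII`: `SU(p, q)`;
* `BDI`: `SO₀(p, q)`;
* `CI`: `Sp(n, ℝ)`;
* `CII`: `Sp(p, q)`, as the quaternionic matrices that preserve the Hermitian form of signature
  `(p, q)`;
* `DIII`: `SO*(2n)`. -/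
def forms : (c : CartanClass) → FormData c.Idx
  | AI n => ⟨∅, ∅, {(1 : Matrix (Fin n) (Fin n) ℂ)}⟩
  | AII n => ⟨∅, ∅, {Matrix.J (Fin n) ℂ}⟩
  | AIII p q => ⟨∅, {signature p q}, ∅⟩
  | BDI p q => ⟨{signature p q}, ∅, {(1 : Matrix (Fin p ⊕ Fin q) (Fin p ⊕ Fin q) ℂ)}⟩
  | CI n => ⟨{Matrix.J (Fin n) ℂ}, ∅, {(1 : Matrix (Fin n ⊕ Fin n) (Fin n ⊕ Fin n) ℂ)}⟩
  | CII p q => ⟨∅, {Matrix.fromBlocks (signature p q) 0 0 (signature p q)},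
      {Matrix.J (Fin p ⊕ Fin q) ℂ}⟩
  | DIII n => ⟨{(1 : Matrix (Fin n ⊕ Fin n) (Fin n ⊕ Fin n) ℂ)}, {Matrix.J (Fin n) ℂ}, ∅⟩

/-- The type of the restricted root system. -/
def rootType : CartanClass → RootType
  | AI _ => .A
  | AII _ => .A
  | AIII p q => if p = q then .C else .BC
  | BDI p q => if p = q then .D else .B
  | CI _ => .C
  | CII p q => if p = q then .C else .BC
  | DIII n => if Even n then .C else .BC

/-- The number of coordinates used for elements of `𝔞`: the rank plus one if the restricted root
system is of type `A`, and the rank otherwise. -/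
def dim : CartanClass → ℕ
  | AI n => n
  | AII n => n
  | AIII p _ => p
  | BDI p _ => p
  | CI n => n
  | CII p _ => p
  | DIII n => n / 2

/-- The real diagonal matrix with entries `x`. -/
def realDiagonal {n : ℕ} (x : Fin n → ℝ) : Matrix (Fin n) (Fin n) ℂ :=
  Matrix.diagonal fun i => (x i : ℂ)

/-- The matrix `[0, Z; Zᵀ, 0]` where the `p × q` matrix `Z` has the entries `x` on its diagonal
and zeros elsewhere. -/
def offDiagonal {p : ℕ} (q : ℕ) (x : Fin p → ℝ) : Matrix (Fin p ⊕ Fin q) (Fin p ⊕ Fin q) ℂ :=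
  let Z : Matrix (Fin p) (Fin q) ℂ := Matrix.of fun i j => if (i : ℕ) = (j : ℕ) then (x i : ℂ) else 0
  Matrix.fromBlocks 0 Z Zᵀ 0

/-- The purely imaginary `n × n` matrix `H` that is block diagonal with the `2 × 2` blocks
`[0, i x_k; -i x_k, 0]`, and a last entry `0` if `n` is odd. -/
noncomputable def imaginaryBlocks (n : ℕ) (x : Fin (n / 2) → ℝ) : Matrix (Fin n) (Fin n) ℂ :=
  ∑ k : Fin (n / 2),
    (Matrix.single ⟨2 * (k : ℕ), by omega⟩ ⟨2 * (k : ℕ) + 1, by omega⟩ (Complex.I * (x k : ℂ)) -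
      Matrix.single ⟨2 * (k : ℕ) + 1, by omega⟩ ⟨2 * (k : ℕ), by omega⟩ (Complex.I * (x k : ℂ)))

/-- The element with coordinate vector `x` of the standard maximal abelian subspace `𝔞` of `𝔭`.
For the types `AI` and `AII` it lies in `𝔭` only if `∑ x j = 0`. -/
noncomputable def torus : (c : CartanClass) → (Fin c.dim → ℝ) → Matrix c.Idx c.Idx ℂ
  | AI _, x => realDiagonal x
  | AII _, x => Matrix.fromBlocks (realDiagonal x) 0 0 (realDiagonal x)
  | AIII _ q, x => offDiagonal q x
  | BDI _ q, x => offDiagonal q x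
  | CI _, x => Matrix.fromBlocks (realDiagonal x) 0 0 (-realDiagonal x)
  | CII _ q, x => Matrix.fromBlocks (offDiagonal q x) 0 0 (offDiagonal q x)
  | DIII n, x => Matrix.fromBlocks (imaginaryBlocks n x) 0 0 (-imaginaryBlocks n x)

end CartanClass

/-! ### Type and eligibility -/

namespace RootType

variable {r : ℕ}

/-- The number `J` of zero coordinates. -/
noncomputable def zeroMult (x : Fin r → ℝ) : ℕ := {j | x j = 0}.ncard

/-- `max s_j` in type `A`: the largest number of equal coordinates. -/
noncomputable def maxMult (x : Fin r → ℝ) : ℕ :=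
  Finset.univ.sup fun i => {j | x j = x i}.ncard

open Classical in
/-- `max s_j` in types `B`, `C`, `D`, `BC`: the largest number of nonzero coordinates that are equal
up to sign, and `0` if all coordinates vanish. -/
noncomputable def maxAbsMult (x : Fin r → ℝ) : ℕ :=
  Finset.univ.sup fun i => if x i = 0 then 0 else {j | |x j| = |x i|}.ncard

/-- Dominant `B`, `C`, `D` or `BC` type: `2J ≥ max s_j`. Otherwise `x` is of dominant `SU` type. -/
def Dominant (x : Fin r → ℝ) : Prop := maxAbsMult x ≤ 2 * zeroMult x

open Classical in
/-- The number `S_X` for `X ∈ 𝔞` with coordinate vector `x`. -/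
noncomputable def S : RootType → (Fin r → ℝ) → ℕ
  | .A, x => maxMult x
  | _, x => if Dominant x then 2 * zeroMult x else maxAbsMult x

/-- Eligibility of a tuple with coordinate vectors `x 0, …, x (L-1)` in `ℝ^r`. In type `A` the rank
is `r - 1`, otherwise it is `r`. -/
def Eligible (t : RootType) {L : ℕ} (x : Fin L → Fin r → ℝ) : Prop :=
  match t with
  | .A => ∑ i, (S .A (x i) : ℤ) ≤ ((L : ℤ) - 1) * r
  | t => ∑ i, (S t (x i) : ℤ) ≤ ((L : ℤ) - 1) * (2 * r)

end RootType

/-- A measurable set meeting every line through `y₀` in a countable set is a null set. -/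
theorem MeasureTheory.Measure.addHaar_eq_zero_of_countable_lines {V : Type*} [NormedAddCommGroup V]
    [NormedSpace ℝ V] [FiniteDimensional ℝ V] [MeasurableSpace V] [BorelSpace V]
    (μ : Measure V) [μ.IsAddHaarMeasure] {S : Set V} (hS : MeasurableSet S) (y₀ : V)
    (h : ∀ y, {t : ℝ | y₀ + t • y ∈ S}.Countable) : μ S = 0 := by
  have hm : Measurable fun z : V × ℝ => y₀ + z.2 • z.1 := by
    have : Continuous fun z : V × ℝ => y₀ + z.2 • z.1 := by fun_prop
    exact this.measurable
  have hT : (μ.prod volume) ((fun z : V × ℝ => y₀ + z.2 • z.1) ⁻¹' S) = 0 := by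
    rw [Measure.measure_prod_null (hm hS)]
    exact .of_forall fun y => (h y).measure_zero _
  have hT' : ((volume : Measure ℝ).prod μ) ((fun z : ℝ × V => y₀ + z.1 • z.2) ⁻¹' S) = 0 := by
    rw [← Measure.prod_swap, Measure.map_apply measurable_swap]
    · exact hT
    · exact (hm.comp measurable_swap) hS
  have h1 := Measure.measure_ae_null_of_prod_null hT'
  have h2 : ∀ᵐ t : ℝ, t ≠ 0 := by
    rw [ae_iff]; simp
  obtain ⟨t, ht, ht0⟩ := (h1.and h2).exists
  have h3 : μ ((fun y => t • y) ⁻¹' ((fun y => y₀ + y) ⁻¹' S)) = 0 := ht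
  rw [Measure.addHaar_preimage_smul μ ht0, measure_preimage_add] at h3
  rcases mul_eq_zero.1 h3 with h4 | h4
  · simp [ht0] at h4
  · exact h4

/-- Version of `addHaar_eq_zero_of_countable_lines` without a choice of norm. -/
theorem MeasureTheory.Measure.addHaar_eq_zero_of_countable_lines' {V : Type*} [AddCommGroup V]
    [Module ℝ V] [TopologicalSpace V] [IsTopologicalAddGroup V] [ContinuousSMul ℝ V] [T2Space V]
    [FiniteDimensional ℝ V] [MeasurableSpace V] [BorelSpace V]
    (μ : Measure V) [μ.IsAddHaarMeasure] {S : Set V} (hS : MeasurableSet S) (y₀ : V)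
    (h : ∀ y, {t : ℝ | y₀ + t • y ∈ S}.Countable) : μ S = 0 := by
  let e : V ≃L[ℝ] (Fin (Module.finrank ℝ V) → ℝ) :=
    ContinuousLinearEquiv.ofFinrankEq (by simp)
  have := e.isAddHaarMeasure_map μ
  have hS' : MeasurableSet (e.symm ⁻¹' S) := e.symm.continuous.measurable hS
  have h0 := (μ.map e).addHaar_eq_zero_of_countable_lines hS' (e y₀) fun y => by
    simpa using h (e.symm y)
  rw [Measure.map_apply e.continuous.measurable hS'] at h0
  convert h0
  ext v
  simp

namespace Matrix

theorem finite_setOf_det_add_smul_eq_zero {ι : Type*} [Fintype ι] [DecidableEq ι]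
    {A : Matrix ι ι ℂ} (B : Matrix ι ι ℂ) (hA : A.det ≠ 0) :
    {t : ℝ | (A + t • B).det = 0}.Finite := by
  classical
  set p : Polynomial ℂ :=
    ((Polynomial.X : Polynomial ℂ) • B.map Polynomial.C + A.map Polynomial.C).det with hp
  have hp0 : p ≠ 0 := by
    intro h
    have := Polynomial.coeff_det_X_add_C_zero B A
    rw [← hp, h] at this
    exact hA (by simpa using this.symm)
  refine (p.roots.toFinset.finite_toSet.preimage (f := ((↑) : ℝ → ℂ))
    Complex.ofReal_injective.injOn).subset fun t ht => ?_
  have hev : p.eval (t : ℂ) = (A + t • B).det := by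
    rw [hp, ← Polynomial.coe_evalRingHom, RingHom.map_det]
    congr 1
    ext i j
    simp only [RingHom.mapMatrix_apply, map_apply, add_apply, smul_apply, smul_eq_mul,
      Polynomial.coe_evalRingHom, Polynomial.eval_add, Polynomial.eval_mul, Polynomial.eval_X,
      Polynomial.eval_C, Complex.real_smul]
    ring
  have ht' : (A + t • B).det = 0 := ht
  simp [hp0, hev, ht']

theorem rank_add_le' {m n R : Type*} [Fintype m] [Fintype n] [Field R] (A B : Matrix m n R) :
    (A + B).rank ≤ A.rank + B.rank := by
  rw [rank, rank, rank, mulVecLin_add]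
  refine (Submodule.finrank_mono (LinearMap.range_add_le _ _)).trans ?_
  exact Submodule.finrank_add_le_finrank_add_finrank _ _

theorem rank_sum_le' {κ m n R : Type*} [Fintype m] [Fintype n] [Field R] (s : Finset κ)
    (A : κ → Matrix m n R) : (∑ i ∈ s, A i).rank ≤ ∑ i ∈ s, (A i).rank := by
  classical
  induction s using Finset.induction_on with
  | empty => simp
  | insert a s ha ih =>
    rw [Finset.sum_insert ha, Finset.sum_insert ha]
    exact (rank_add_le' _ _).trans (by gcongr)

theorem rank_conj_sub_smul_one_le {ι R : Type*} [Fintype ι] [DecidableEq ι] [Field R]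
    (g : GL ι R) (A : Matrix ι ι R) (a : R) :
    ((g : Matrix ι ι R) * A * ((g⁻¹ : GL ι R) : Matrix ι ι R) - a • 1).rank
      ≤ (A - a • 1).rank := by
  have h : (g : Matrix ι ι R) * A * ((g⁻¹ : GL ι R) : Matrix ι ι R) - a • 1
      = (g : Matrix ι ι R) * (A - a • 1) * ((g⁻¹ : GL ι R) : Matrix ι ι R) := by
    simp [mul_sub, sub_mul]
  rw [h]
  exact (rank_mul_le_left _ _).trans (rank_mul_le_right _ _)

theorem det_eq_zero_of_rank_lt {ι R : Type*} [Fintype ι] [DecidableEq ι] [Field R]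
    {A : Matrix ι ι R} (h : A.rank < Fintype.card ι) : A.det = 0 := by
  by_contra hA
  exact h.ne (rank_of_det_ne_zero hA)

end Matrix

namespace FormData

variable {ι : Type} [Fintype ι] [DecidableEq ι]

instance : SecondCountableTopology (Matrix ι ι ℂ) :=
  inferInstanceAs (SecondCountableTopology (ι → ι → ℂ))

instance (D : FormData ι) : SecondCountableTopology D.𝔭 :=
  TopologicalSpace.Subtype.secondCountableTopology _

instance (D : FormData ι) : MeasurableAdd₂ D.𝔭 :=
  ⟨continuous_add.measurable⟩

theorem lebesgue_det_zero_locus (D : FormData ι) (B : Matrix ι ι ℂ) (Y₀ : D.𝔭)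
    (h : ((Y₀ : Matrix ι ι ℂ) + B).det ≠ 0) :
    D.lebesgue {Y : D.𝔭 | ((Y : Matrix ι ι ℂ) + B).det = 0} = 0 := by
  have hc : Continuous fun Y : D.𝔭 => ((Y : Matrix ι ι ℂ) + B).det := by fun_prop
  refine Measure.addHaar_eq_zero_of_countable_lines' (V := D.𝔭) Measure.addHaar
    (isClosed_eq hc continuous_const).measurableSet Y₀ fun Y => ?_
  convert (finite_setOf_det_add_smul_eq_zero (Y : Matrix ι ι ℂ) h).countable using 4
  rw [Set.mem_ofPred_eq, Submodule.coe_add, Submodule.coe_smul, add_right_comm]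

theorem continuous_Ad (D : FormData ι) (X : D.𝔭) : Continuous fun k => D.Ad k X := by
  have h1 : Continuous fun k : D.K => ((k : GL ι ℂ) : Matrix ι ι ℂ) :=
    Units.continuous_val.comp continuous_subtype_val
  have h2 : Continuous fun k : D.K => (((k : GL ι ℂ)⁻¹ : GL ι ℂ) : Matrix ι ι ℂ) :=
    Units.continuous_val.comp (continuous_inv.comp continuous_subtype_val)
  exact ((h1.mul continuous_const).mul h2).subtype_mk _

theorem orbitalMeasure_compl_orbit (D : FormData ι) (X : D.𝔭) :
    D.orbitalMeasure X (Set.range fun k => D.Ad k X)ᶜ = 0 := by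
  have hc := D.continuous_Ad X
  rw [orbitalMeasure, Measure.map_apply hc.measurable
    (isCompact_range hc).isClosed.measurableSet.compl]
  have he : (fun k => D.Ad k X) ⁻¹' (Set.range fun k => D.Ad k X)ᶜ = ∅ := by
    ext k
    simp
  rw [he, measure_empty]

instance (D : FormData ι) : IsFiniteMeasure D.haarK := by
  unfold haarK; infer_instance

instance (D : FormData ι) (X : D.𝔭) : IsFiniteMeasure (D.orbitalMeasure X) := by
  unfold orbitalMeasure; infer_instance

instance (D : FormData ι) {L : ℕ} (X : Fin L → D.𝔭) : IsFiniteMeasure (D.orbitalConvolution X) := by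
  unfold orbitalConvolution
  induction L with
  | zero => simp only [List.ofFn_zero, List.foldr_nil]; infer_instance
  | succ L ih =>
    have := ih fun i => X i.succ
    simp only [List.ofFn_succ, List.foldr_cons]
    infer_instance

theorem exists_compact_support_orbitalConvolution (D : FormData ι) {L : ℕ} (X : Fin L → D.𝔭) :
    ∃ C : Set D.𝔭, IsCompact C ∧ D.orbitalConvolution X Cᶜ = 0 ∧
      ∀ Y ∈ C, ∃ k : Fin L → D.K, Y = ∑ i, D.Ad (k i) (X i) := by
  induction L with
  | zero => exact ⟨{0}, isCompact_singleton, by simp [orbitalConvolution], by simp⟩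
  | succ L ih =>
    obtain ⟨C, hC, hC0, hCk⟩ := ih fun i => X i.succ
    have hO := isCompact_range (D.continuous_Ad (X 0))
    refine ⟨_, (hO.prod hC).image continuous_add, ?_, ?_⟩
    · have he : D.orbitalConvolution X
          = (D.orbitalMeasure (X 0)).conv (D.orbitalConvolution fun i => X i.succ) := by
        simp [orbitalConvolution, List.ofFn_succ]
      rw [he, Measure.conv, Measure.map_apply measurable_add
        ((hO.prod hC).image continuous_add).isClosed.measurableSet.compl]
      refine measure_mono_null (t := (Set.range fun k => D.Ad k (X 0))ᶜ ×ˢ Set.univ ∪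
        Set.univ ×ˢ Cᶜ) ?_ ?_
      · rintro ⟨a, b⟩ hab
        by_contra hcon
        simp only [Set.mem_union, Set.mem_prod, Set.mem_compl_iff, Set.mem_univ, and_true,
          true_and, not_or, not_not] at hcon
        exact hab ⟨(a, b), hcon, rfl⟩
      · refine measure_union_null ?_ ?_
        · rw [Measure.prod_prod, D.orbitalMeasure_compl_orbit, zero_mul]
        · rw [Measure.prod_prod, hC0, mul_zero]
    · rintro _ ⟨⟨_, b⟩, ⟨⟨k₀, rfl⟩, hb⟩, rfl⟩
      obtain ⟨k, rfl⟩ := hCk b hb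
      exact ⟨Fin.cons k₀ k, by simp [Fin.sum_univ_succ]⟩

/-- If the ranks of `X i - a i` add up to so little that every sum of conjugates of the `X i` has
`∑ i, a i` as an eigenvalue of exceptionally large multiplicity, then the convolution of the orbital
measures is singular. -/
theorem mutuallySingular_of_sum_rank_lt (D : FormData ι) {L : ℕ} (X : Fin L → D.𝔭) (a : Fin L → ℂ)
    (E : Matrix ι ι ℂ)
    (hlt : ∑ i, ((X i : Matrix ι ι ℂ) - a i • 1).rank + E.rank < Fintype.card ι)
    (Y₀ : D.𝔭) (hY₀ : ((Y₀ : Matrix ι ι ℂ) + (E - (∑ i, a i) • 1)).det ≠ 0) :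
    D.orbitalConvolution X ⟂ₘ D.lebesgue := by
  obtain ⟨C, hC, hC0, hCk⟩ := D.exists_compact_support_orbitalConvolution X
  refine ⟨Cᶜ, hC.isClosed.measurableSet.compl, hC0, ?_⟩
  rw [compl_compl]
  refine measure_mono_null (fun Y hY => ?_) (D.lebesgue_det_zero_locus _ Y₀ hY₀)
  obtain ⟨k, rfl⟩ := hCk Y hY
  refine det_eq_zero_of_rank_lt (lt_of_le_of_lt ?_ hlt)
  have he : ((∑ i, D.Ad (k i) (X i) : D.𝔭) : Matrix ι ι ℂ) + (E - (∑ i, a i) • 1)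
      = ∑ i, ((D.Ad (k i) (X i) : Matrix ι ι ℂ) - a i • 1) + E := by
    rw [Finset.sum_sub_distrib, Finset.sum_smul, Submodule.coe_sum]
    abel
  rw [he]
  refine (rank_add_le' _ _).trans ?_
  gcongr
  refine (rank_sum_le' _ _).trans ?_
  gcongr
  exact rank_conj_sub_smul_one_le _ _ _

end FormData

namespace Matrix

theorem rank_fromBlocks_diagonal_le {m n R : Type*} [Fintype m] [Fintype n] [DecidableEq m]
    [DecidableEq n] [Field R] (A : Matrix m m R) (B : Matrix n n R) :
    (fromBlocks A 0 0 B).rank ≤ A.rank + B.rank := by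
  have h : fromBlocks A 0 0 B = fromRows (1 : Matrix m m R) (0 : Matrix n m R) * A *
        fromCols (1 : Matrix m m R) (0 : Matrix m n R) +
      fromRows (0 : Matrix m n R) (1 : Matrix n n R) * B *
        fromCols (0 : Matrix n m R) (1 : Matrix n n R) := by
    ext (i | i) (j | j) <;> simp [fromRows_mul, mul_fromCols]
  rw [h]
  refine (rank_add_le' _ _).trans (add_le_add ?_ ?_)
  all_goals exact (rank_mul_le_left _ _).trans (rank_mul_le_right _ _)

theorem rank_single_le {ι R : Type*} [Fintype ι] [DecidableEq ι] [Field R] (i j : ι) (c : R) :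
    (single i j c).rank ≤ 1 := by
  rw [← Finset.card_singleton i]
  refine rank_le_card_of_support_subset _ _ fun k hk => ?_
  by_contra hne
  refine hk (funext fun l => ?_)
  have : i ≠ k := fun h => hne (by simp [h])
  simp [row, this]

/-- The matrix that has the blocks `[0, a x_k; a⁻¹ x_k, 0]` in the rows and columns `u k`, `v k`. -/
noncomputable def pairMatrix {ι : Type*} [DecidableEq ι] {m : ℕ} (u v : Fin m → ι) (a : ℂ)
    (x : Fin m → ℝ) : Matrix ι ι ℂ :=
  ∑ k, (single (u k) (v k) (a * x k) + single (v k) (u k) (a⁻¹ * x k))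

section pairMatrix

variable {ι : Type*} [DecidableEq ι] {m : ℕ} {u v : Fin m → ι} {a : ℂ}

theorem pairMatrix_apply_left (hu : u.Injective) (huv : ∀ j k, u j ≠ v k) (x : Fin m → ℝ)
    (i : ι) (k : Fin m) :
    pairMatrix u v a x i (u k) = if i = v k then a⁻¹ * x k else 0 := by
  rw [pairMatrix, sum_apply, Finset.sum_eq_single k]
  · simp [single_apply, (huv k k).symm, eq_comm]
  · intro b _ hb
    simp [(huv k b).symm, hu.eq_iff, hb]
  · simp

theorem pairMatrix_apply_right (hv : v.Injective) (huv : ∀ j k, u j ≠ v k) (x : Fin m → ℝ)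
    (i : ι) (k : Fin m) :
    pairMatrix u v a x i (v k) = if i = u k then a * x k else 0 := by
  rw [pairMatrix, sum_apply, Finset.sum_eq_single k]
  · simp [single_apply, huv k k, eq_comm]
  · intro b _ hb
    simp [huv b k, hv.eq_iff, hb]
  · simp

theorem pairMatrix_apply_of_ne (x : Fin m → ℝ) (i : ι) {j : ι} (hju : ∀ k, u k ≠ j)
    (hjv : ∀ k, v k ≠ j) : pairMatrix u v a x i j = 0 := by
  rw [pairMatrix, sum_apply]
  exact Finset.sum_eq_zero fun k _ => by simp [hju, hjv]

variable [Fintype ι]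

theorem rank_pairMatrix_add_le (x : Fin m → ℝ) :
    (pairMatrix u v a x).rank + 2 * RootType.zeroMult x ≤ 2 * m := by
  classical
  have h1 : (pairMatrix u v a x).rank ≤ ∑ k, if x k = 0 then 0 else 2 := by
    refine (rank_sum_le' _ _).trans (Finset.sum_le_sum fun k _ => ?_)
    split_ifs with hk
    · simp [hk]
    · exact (rank_add_le' _ _).trans (add_le_add (rank_single_le _ _ _) (rank_single_le _ _ _))
  have h2 : 2 * RootType.zeroMult x = ∑ k, if x k = 0 then 2 else 0 := by
    rw [RootType.zeroMult, Set.ncard_eq_toFinset_card', ← Finset.sum_filter, Finset.sum_const,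
      smul_eq_mul, mul_comm]
    congr 2
    ext
    simp
  have h3 : (∑ k, if x k = 0 then 0 else 2) + (∑ k, if x k = 0 then 2 else 0) = 2 * m := by
    rw [← Finset.sum_add_distrib, Finset.sum_congr rfl (g := fun _ => 2)
      (fun k _ => by split_ifs <;> rfl)]
    simp [mul_comm]
  omega

theorem rank_pairMatrix_sub_add_le (hu : u.Injective) (hv : v.Injective)
    (huv : ∀ j k, u j ≠ v k) (ha : a ≠ 0) (x : Fin m → ℝ) {b : ℝ} (hb : b ≠ 0) :
    (pairMatrix u v a x - (b : ℂ) • 1).rank + {j | |x j| = |b|}.ncard ≤ Fintype.card ι := by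
  classical
  set s := {j | |x j| = |b|} with hs
  let c : s → ℂ := fun k => a⁻¹ * x k / b
  let W : Matrix ι s ℂ := of fun i k => if i = u k then 1 else if i = v k then c k else 0
  have hb' : (b : ℂ) ≠ 0 := by exact_mod_cast hb
  have hmul : (pairMatrix u v a x - (b : ℂ) • 1) * W = 0 := by
    ext i k
    have hW : (fun j => W j k) = Pi.single (u k) 1 + Pi.single (v k) (c k) := by
      ext j
      by_cases h1 : j = u k
      · subst h1
        simp [W, huv k k]
      · by_cases h2 : j = v k
        · subst h2
          simp [W, (huv k k).symm]
        · simp [W, h1, h2]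
    have hx : (x k : ℂ) * x k = b * b := by
      have : |x k| * |x k| = |b| * |b| := by rw [show |x k| = |b| from k.2]
      rw [abs_mul_abs_self, abs_mul_abs_self] at this
      exact_mod_cast this
    have : ((pairMatrix u v a x - (b : ℂ) • 1) *ᵥ fun j => W j k) i = 0 := by
      rw [hW, mulVec_add, Pi.add_apply, mulVec_single, mulVec_single]
      simp only [Pi.smul_apply, col_apply, sub_apply, pairMatrix_apply_left hu huv,
        pairMatrix_apply_right hv huv, smul_apply, one_apply]
      by_cases h1 : i = u k
      · subst h1
        simp only [huv k k, if_false, if_true, c, MulOpposite.smul_eq_mul_unop,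
          MulOpposite.unop_op, smul_eq_mul]
        field_simp
        linear_combination a * hx
      · by_cases h2 : i = v k
        · subst h2
          simp only [(huv k k).symm, if_false, if_true, c, MulOpposite.smul_eq_mul_unop,
            MulOpposite.unop_op, smul_eq_mul]
          field_simp
          ring
        · simp [h1, h2]
    exact this
  have hW : Fintype.card s ≤ W.rank := by
    have h1 : W.submatrix (fun k : s => u k) id = 1 := by
      ext j k
      simp [W, hu.eq_iff, huv, one_apply, Subtype.ext_iff]
    have := rank_submatrix_le W (fun k : s => u k) id
    rwa [h1, rank_one] at this
  have := rank_add_rank_le_card_of_mul_eq_zero hmul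
  rw [Set.ncard_eq_toFinset_card', Set.toFinset_card]
  omega

/-- The diagonal projection on the coordinates outside the ranges of `u` and `v`. -/
noncomputable def pairComplement (u v : Fin m → ι) : Matrix ι ι ℂ :=
  open Classical in diagonal fun i => if i ∈ Set.range u ∪ Set.range v then 0 else 1

theorem rank_pairComplement (hu : u.Injective) (hv : v.Injective) (huv : ∀ j k, u j ≠ v k) :
    (pairComplement u v).rank + 2 * m = Fintype.card ι := by
  classical
  rw [pairComplement, rank_diagonal]
  have hS : (Set.range u ∪ Set.range v).ncard = 2 * m := by
    rw [Set.ncard_union_eq (Set.disjoint_left.2 ?_), ← Set.image_univ, ← Set.image_univ,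
      Set.ncard_image_of_injective _ hu, Set.ncard_image_of_injective _ hv, Set.ncard_univ,
      Nat.card_fin]
    · ring
    · rintro _ ⟨j, rfl⟩ ⟨k, hk⟩
      exact huv j k hk.symm
  have hc := Set.ncard_add_ncard_compl (Set.range u ∪ Set.range v)
  rw [hS, Nat.card_eq_fintype_card] at hc
  rw [← hc, add_comm, Fintype.card_subtype, Set.ncard_eq_toFinset_card']
  congr 2
  ext i
  simp

theorem det_pairMatrix_add_pairComplement_ne_zero (hu : u.Injective) (hv : v.Injective)
    (huv : ∀ j k, u j ≠ v k) (ha : a ≠ 0) {x : Fin m → ℝ} (hx : ∀ k, x k * x k = 1) :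
    (pairMatrix u v a x + pairComplement u v).det ≠ 0 := by
  classical
  have hx' (k : Fin m) : (x k : ℂ) * x k = 1 := by exact_mod_cast hx k
  set Q := pairMatrix u v a x + pairComplement u v with hQ
  have hQu (i : ι) (k : Fin m) : Q i (u k) = if i = v k then a⁻¹ * x k else 0 := by
    rw [hQ, add_apply, pairMatrix_apply_left hu huv]
    simp +contextual [pairComplement, diagonal_apply]
  have hQv (i : ι) (k : Fin m) : Q i (v k) = if i = u k then a * x k else 0 := by
    rw [hQ, add_apply, pairMatrix_apply_right hv huv]
    simp +contextual [pairComplement, diagonal_apply]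
  have hQQ : Q * Q = 1 := by
    ext i j
    rw [mul_apply]
    by_cases h1 : ∃ k, u k = j
    · obtain ⟨k, rfl⟩ := h1
      simp only [hQu, mul_ite, mul_zero, Finset.sum_ite_eq', Finset.mem_univ,
        if_true, hQv, one_apply, ite_mul, zero_mul]
      congr 1
      field_simp
      linear_combination hx' k
    by_cases h2 : ∃ k, v k = j
    · obtain ⟨k, rfl⟩ := h2
      simp only [hQv, mul_ite, mul_zero, Finset.sum_ite_eq', Finset.mem_univ,
        if_true, hQu, one_apply, ite_mul, zero_mul]
      congr 1
      field_simp
      linear_combination hx' k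
    push Not at h1 h2
    have hQj (i : ι) : Q i j = if i = j then 1 else 0 := by
      rw [hQ, add_apply, pairMatrix_apply_of_ne x i h1 h2, zero_add, pairComplement, diagonal_apply]
      by_cases hij : i = j
      · subst hij
        simp [h1, h2]
      · simp [hij]
    simp [hQj, one_apply]
  intro h0
  have := congrArg det hQQ
  simp [h0] at this

end pairMatrix

end Matrix

namespace RootType

variable {r : ℕ}

theorem zeroMult_le (x : Fin r → ℝ) : zeroMult x ≤ r :=
  (Set.ncard_le_card _).trans (by simp)

theorem maxAbsMult_le (x : Fin r → ℝ) : maxAbsMult x ≤ r := by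
  refine Finset.sup_le fun i _ => ?_
  split_ifs
  · exact Nat.zero_le _
  · exact (Set.ncard_le_card _).trans (by simp)

theorem exists_ncard_eq_maxAbsMult {x : Fin r → ℝ} (h : ¬ Dominant x) :
    ∃ b : ℝ, b ≠ 0 ∧ {j | |x j| = |b|}.ncard = maxAbsMult x := by
  classical
  have hpos : 0 < maxAbsMult x := by
    unfold Dominant at h
    omega
  have hne : (Finset.univ : Finset (Fin r)).Nonempty := by
    by_contra hcon
    rw [Finset.not_nonempty_iff_eq_empty] at hcon
    simp [maxAbsMult, hcon] at hpos
  obtain ⟨i, -, hi⟩ := Finset.exists_mem_eq_sup _ hne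
    fun i => if x i = 0 then 0 else {j | |x j| = |x i|}.ncard
  by_cases h0 : x i = 0
  · rw [if_pos h0] at hi
    have : maxAbsMult x = 0 := by rw [← hi, maxAbsMult]
    omega
  · refine ⟨x i, h0, ?_⟩
    rw [if_neg h0] at hi
    rw [← hi, maxAbsMult]

theorem exists_ncard_eq_maxMult (hr : 0 < r) (x : Fin r → ℝ) :
    ∃ b : ℝ, {j | x j = b}.ncard = maxMult x := by
  obtain ⟨i, -, hi⟩ := Finset.exists_mem_eq_sup Finset.univ ⟨⟨0, hr⟩, Finset.mem_univ _⟩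
    fun i => {j | x j = x i}.ncard
  exact ⟨x i, hi.symm⟩

end RootType

namespace FormData

open RootType

variable {ι : Type} [Fintype ι] [DecidableEq ι]

/-- Singularity in the types `B`, `C`, `D`, `BC`, from bounds for the ranks of `T x - b`, where `T`
parametrizes the maximal abelian subspace. -/
theorem mutuallySingular_of_not_eligible (D : FormData ι) {M e r : ℕ} (hM : 1 ≤ M)
    (T : (Fin r → ℝ) → Matrix ι ι ℂ) (hcard : Fintype.card ι = M * (2 * r) + e)
    (h0 : ∀ x, (T x).rank + M * (2 * zeroMult x) ≤ M * (2 * r))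
    (h1 : ∀ x (b : ℝ), b ≠ 0 →
      (T x - (b : ℂ) • 1).rank + M * {j | |x j| = |b|}.ncard ≤ Fintype.card ι)
    (Y₀ : Matrix ι ι ℂ) (hY₀ : Y₀ ∈ D.𝔭) (E : Matrix ι ι ℂ) (hE : E.rank ≤ e)
    (hdet : (Y₀ + E).det ≠ 0)
    {L : ℕ} (X : Fin L → D.𝔭) (x : Fin L → Fin r → ℝ)
    (hX : ∀ i, (X i : Matrix ι ι ℂ) = T (x i))
    (hne : ¬ ∑ i, (S .C (x i) : ℤ) ≤ ((L : ℤ) - 1) * (2 * r)) :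
    D.orbitalConvolution X ⟂ₘ D.lebesgue := by
  classical
  have hne' : L * (2 * r) + 1 ≤ ∑ i, S .C (x i) + 2 * r := by
    push Not at hne
    zify
    linarith
  have hMne : M * (L * (2 * r)) + M ≤ M * ∑ i, S .C (x i) + M * (2 * r) := by nlinarith
  have hSd {i} (hi : Dominant (x i)) : S .C (x i) = 2 * zeroMult (x i) := by simp [S, hi]
  have hSn {i} (hi : ¬ Dominant (x i)) : S .C (x i) = maxAbsMult (x i) := by simp [S, hi]
  have hS2 (i) : S .C (x i) ≤ 2 * r := by
    by_cases hi : Dominant (x i)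
    · rw [hSd hi]; have := zeroMult_le (x i); omega
    · rw [hSn hi]; have := maxAbsMult_le (x i); omega
  have hrd {i} (hi : Dominant (x i)) :
      ((X i : Matrix ι ι ℂ) - (0 : ℂ) • 1).rank + M * S .C (x i) ≤ M * (2 * r) := by
    rw [hSd hi, zero_smul, sub_zero, hX]
    exact h0 _
  by_cases hall : ∀ i, Dominant (x i)
  · refine D.mutuallySingular_of_sum_rank_lt X 0 E ?_ ⟨Y₀, hY₀⟩ (by simpa using hdet)
    have hsum : ∑ i, ((X i : Matrix ι ι ℂ) - (0 : Fin L → ℂ) i • 1).rank + M * ∑ i, S .C (x i)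
        ≤ M * (L * (2 * r)) := by
      rw [Finset.mul_sum, ← Finset.sum_add_distrib]
      refine (Finset.sum_le_sum fun i _ => hrd (hall i)).trans (le_of_eq ?_)
      simp
      ring
    omega
  · push Not at hall
    obtain ⟨i₀, hi₀⟩ := hall
    have huniq (j) (hj : j ≠ i₀) : Dominant (x j) := by
      by_contra hcon
      have : ∑ i, (S .C (x i) + (if i = i₀ then r else 0) + (if i = j then r else 0))
          ≤ ∑ i : Fin L, 2 * r := by
        refine Finset.sum_le_sum fun i _ => ?_
        by_cases h1 : i = i₀
        · subst h1
          have := maxAbsMult_le (x i)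
          rw [hSn hi₀, if_pos rfl, if_neg (Ne.symm hj)]
          omega
        by_cases h2 : i = j
        · subst h2
          have := maxAbsMult_le (x i)
          rw [hSn hcon, if_neg h1, if_pos rfl]
          omega
        · rw [if_neg h1, if_neg h2]
          exact hS2 i
      rw [Finset.sum_add_distrib, Finset.sum_add_distrib] at this
      simp only [Finset.sum_ite_eq', Finset.mem_univ, if_true, Finset.sum_const,
        Finset.card_univ, Fintype.card_fin, smul_eq_mul] at this
      omega
    obtain ⟨b, hb, hbS⟩ := exists_ncard_eq_maxAbsMult hi₀
    refine D.mutuallySingular_of_sum_rank_lt X (Pi.single i₀ (b : ℂ)) 0 ?_ 0 ?_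
    · have hsum : ∑ i, ((X i : Matrix ι ι ℂ) - (Pi.single i₀ (b : ℂ) : Fin L → ℂ) i • 1).rank
          + M * ∑ i, S .C (x i) ≤ M * (L * (2 * r)) + e := by
        rw [Finset.mul_sum, ← Finset.sum_add_distrib]
        have : ∀ i ∈ Finset.univ,
            ((X i : Matrix ι ι ℂ) - (Pi.single i₀ (b : ℂ) : Fin L → ℂ) i • 1).rank
              + M * S .C (x i) ≤ M * (2 * r) + if i = i₀ then e else 0 := by
          intro i _
          by_cases hi : i = i₀
          · subst hi
            rw [Pi.single_eq_same, hX, hSn hi₀, ← hbS, if_pos rfl, ← hcard]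
            exact h1 _ _ hb
          · rw [Pi.single_eq_of_ne hi, if_neg hi]
            exact hrd (huniq i hi)
        refine (Finset.sum_le_sum this).trans (le_of_eq ?_)
        simp [Finset.sum_add_distrib]
        ring
      rw [rank_zero]
      omega
    · have : (Pi.single i₀ (b : ℂ) : Fin L → ℂ) = fun i => if i = i₀ then (b : ℂ) else 0 := by
        ext i; simp [Pi.single_apply]
      simp [this, hb, det_neg]

/-- Singularity in type `A`. -/
theorem mutuallySingular_of_not_eligible_typeA (D : FormData ι) {M r : ℕ} (hM : 1 ≤ M) (hr : 0 < r)
    (T : (Fin r → ℝ) → Matrix ι ι ℂ) (hcard : Fintype.card ι = M * r)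
    (h1 : ∀ x (b : ℝ), (T x - (b : ℂ) • 1).rank + M * {j | x j = b}.ncard ≤ M * r)
    (Y₀ : Matrix ι ι ℂ) (hY₀ : Y₀ ∈ D.𝔭) (hdet : Y₀.det ≠ 0)
    {L : ℕ} (X : Fin L → D.𝔭) (x : Fin L → Fin r → ℝ)
    (hX : ∀ i, (X i : Matrix ι ι ℂ) = T (x i))
    (hne : ¬ ∑ i, (S .A (x i) : ℤ) ≤ ((L : ℤ) - 1) * r) :
    D.orbitalConvolution X ⟂ₘ D.lebesgue := by
  have hne' : L * r + 1 ≤ ∑ i, S .A (x i) + r := by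
    push Not at hne
    zify
    linarith
  have hMne : M * (L * r) + M ≤ M * ∑ i, S .A (x i) + M * r := by nlinarith
  choose b hb using fun i => exists_ncard_eq_maxMult hr (x i)
  have hlt : ∑ i, ((X i : Matrix ι ι ℂ) - (b i : ℂ) • 1).rank + (0 : Matrix ι ι ℂ).rank
      < Fintype.card ι := by
    have hsum : ∑ i, ((X i : Matrix ι ι ℂ) - (b i : ℂ) • 1).rank + M * ∑ i, S .A (x i)
        ≤ M * (L * r) := by
      rw [Finset.mul_sum, ← Finset.sum_add_distrib]
      have : ∀ i ∈ Finset.univ,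
          ((X i : Matrix ι ι ℂ) - (b i : ℂ) • 1).rank + M * S .A (x i) ≤ M * r := by
        intro i _
        rw [hX, S, ← hb i]
        exact h1 _ _
      refine (Finset.sum_le_sum this).trans (le_of_eq ?_)
      simp
      ring
    rw [rank_zero]
    omega
  by_cases h0 : ∑ i, (b i : ℂ) = 0
  · exact D.mutuallySingular_of_sum_rank_lt X _ 0 hlt ⟨Y₀, hY₀⟩ (by simpa [h0] using hdet)
  · exact D.mutuallySingular_of_sum_rank_lt X _ 0 hlt 0 (by simp [h0, det_neg])

end FormData

namespace CartanClass

open RootType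

theorem offDiagonal_eq_pairMatrix {p q : ℕ} (h : p ≤ q) (x : Fin p → ℝ) :
    offDiagonal q x = pairMatrix Sum.inl (Sum.inr ∘ Fin.castLE h) 1 x := by
  have hu : (Sum.inl : Fin p → Fin p ⊕ Fin q).Injective := Sum.inl_injective
  have hv : (Sum.inr ∘ Fin.castLE h : Fin p → Fin p ⊕ Fin q).Injective :=
    Sum.inr_injective.comp (Fin.castLE_injective h)
  have huv : ∀ j k, (Sum.inl : Fin p → Fin p ⊕ Fin q) j ≠ (Sum.inr ∘ Fin.castLE h) k := by simp
  ext i j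
  rcases j with k | l
  · rw [pairMatrix_apply_left hu huv]
    rcases i with i | i <;> simp [offDiagonal, Fin.ext_iff, eq_comm]
  · by_cases hl : (l : ℕ) < p
    · obtain ⟨k, rfl⟩ : ∃ k : Fin p, Fin.castLE h k = l := ⟨⟨l, hl⟩, rfl⟩
      rw [show (Sum.inr (Fin.castLE h k) : Fin p ⊕ Fin q) = (Sum.inr ∘ Fin.castLE h) k from rfl,
        pairMatrix_apply_right hv huv]
      rcases i with i | i
      · by_cases hik : i = k
        · subst hik
          simp [offDiagonal]
        · simp [offDiagonal, hik, Fin.val_inj]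
      · simp [offDiagonal]
    · rw [pairMatrix_apply_of_ne x i (by simp)
        (fun k hk => hl (by simp only [Function.comp, Sum.inr.injEq] at hk; rw [← hk]; simp))]
      rcases i with i | i
      · have : (i : ℕ) ≠ l := by omega
        simp [offDiagonal, this]
      · simp [offDiagonal]

theorem imaginaryBlocks_eq_pairMatrix (n : ℕ) (x : Fin (n / 2) → ℝ) :
    imaginaryBlocks n x = pairMatrix (fun k => ⟨2 * (k : ℕ), by omega⟩)
      (fun k => ⟨2 * (k : ℕ) + 1, by omega⟩) Complex.I x := by
  refine Finset.sum_congr rfl fun k _ => ?_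
  rw [Complex.inv_I, neg_mul, ← single_neg, sub_eq_add_neg]

/-! Symmetries of the matrices of the maximal abelian subspaces. -/

theorem offDiagonal_transpose {p q : ℕ} (x : Fin p → ℝ) :
    (offDiagonal q x)ᵀ = offDiagonal q x := by
  simp [offDiagonal, fromBlocks_transpose]

theorem offDiagonal_map_star {p q : ℕ} (x : Fin p → ℝ) :
    (offDiagonal q x).map star = offDiagonal q x := by
  ext (i | i) (j | j) <;> simp [offDiagonal, apply_ite (starRingEnd ℂ)]

theorem offDiagonal_conjTranspose {p q : ℕ} (x : Fin p → ℝ) :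
    (offDiagonal q x)ᴴ = offDiagonal q x := by
  rw [conjTranspose, offDiagonal_transpose, offDiagonal_map_star]

theorem trace_offDiagonal {p q : ℕ} (x : Fin p → ℝ) : (offDiagonal q x).trace = 0 := by
  simp [offDiagonal, trace, Fintype.sum_sum_type]

theorem offDiagonal_mul_signature {p q : ℕ} (x : Fin p → ℝ) :
    offDiagonal q x * signature p q + signature p q * offDiagonal q x = 0 := by
  simp [offDiagonal, signature, fromBlocks_multiply, fromBlocks_add]

theorem imaginaryBlocks_transpose (n : ℕ) (x : Fin (n / 2) → ℝ) :
    (imaginaryBlocks n x)ᵀ = -imaginaryBlocks n x := by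
  simp [imaginaryBlocks, transpose_sum, transpose_single]

theorem imaginaryBlocks_conjTranspose (n : ℕ) (x : Fin (n / 2) → ℝ) :
    (imaginaryBlocks n x)ᴴ = imaginaryBlocks n x := by
  simp [imaginaryBlocks, conjTranspose_sum, conjTranspose_single, single_neg, add_comm,
    sub_eq_add_neg]

theorem imaginaryBlocks_neg (n : ℕ) (x : Fin (n / 2) → ℝ) :
    imaginaryBlocks n (-x) = -imaginaryBlocks n x := by
  rw [imaginaryBlocks, imaginaryBlocks, ← Finset.sum_neg_distrib]
  refine Finset.sum_congr rfl fun k _ => ?_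
  simp [← single_neg, sub_eq_add_neg, add_comm]

theorem realDiagonal_transpose {n : ℕ} (x : Fin n → ℝ) :
    (realDiagonal x)ᵀ = realDiagonal x := by simp [realDiagonal]

theorem realDiagonal_map_star {n : ℕ} (x : Fin n → ℝ) :
    (realDiagonal x).map star = realDiagonal x := by
  simp [realDiagonal, diagonal_map]

theorem realDiagonal_conjTranspose {n : ℕ} (x : Fin n → ℝ) :
    (realDiagonal x)ᴴ = realDiagonal x := by
  rw [conjTranspose, realDiagonal_transpose, realDiagonal_map_star]

/-! Ranks -/

theorem rank_realDiagonal_sub_add {n : ℕ} (x : Fin n → ℝ) (b : ℝ) :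
    (realDiagonal x - (b : ℂ) • 1).rank + {j | x j = b}.ncard = n := by
  classical
  have h : realDiagonal x - (b : ℂ) • 1 = diagonal fun i => ((x i - b : ℝ) : ℂ) := by
    rw [realDiagonal, smul_one_eq_diagonal, diagonal_sub]
    simp
  rw [h, rank_diagonal, Fintype.card_subtype]
  have hc := Set.ncard_add_ncard_compl {j | x j = b}
  rw [Nat.card_eq_fintype_card, Fintype.card_fin] at hc
  refine Eq.trans ?_ hc
  rw [add_comm]
  congr 1
  rw [Set.ncard_eq_toFinset_card']
  congr 1
  ext i
  simp [sub_eq_zero]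

theorem neg_realDiagonal {n : ℕ} (x : Fin n → ℝ) : -realDiagonal x = realDiagonal (-x) := by
  simp [realDiagonal, diagonal_neg]

theorem fromBlocks_sub_smul_one {m n : Type*} [DecidableEq m] [DecidableEq n]
    (A : Matrix m m ℂ) (B : Matrix n n ℂ) (b : ℂ) :
    fromBlocks A 0 0 B - b • 1 = fromBlocks (A - b • 1) 0 0 (B - b • 1) := by
  rw [← fromBlocks_one, fromBlocks_smul, sub_eq_add_neg, fromBlocks_neg, fromBlocks_add]
  simp [sub_eq_add_neg]

theorem rank_offDiagonal_add_le {p q : ℕ} (h : p ≤ q) (x : Fin p → ℝ) :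
    (offDiagonal q x).rank + 2 * zeroMult x ≤ 2 * p := by
  rw [offDiagonal_eq_pairMatrix h]
  exact rank_pairMatrix_add_le x

theorem rank_offDiagonal_sub_add_le {p q : ℕ} (h : p ≤ q) (x : Fin p → ℝ) {b : ℝ} (hb : b ≠ 0) :
    (offDiagonal q x - (b : ℂ) • 1).rank + {j | |x j| = |b|}.ncard ≤ p + q := by
  rw [offDiagonal_eq_pairMatrix h]
  simpa using rank_pairMatrix_sub_add_le (Sum.inl_injective)
    (Sum.inr_injective.comp (Fin.castLE_injective h)) (by simp) one_ne_zero x hb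

theorem exists_offDiagonal_complement {p q : ℕ} (h : p ≤ q) :
    ∃ E : Matrix (Fin p ⊕ Fin q) (Fin p ⊕ Fin q) ℂ, E.rank + 2 * p = p + q ∧
      (offDiagonal q (fun _ : Fin p => 1) + E).det ≠ 0 := by
  refine ⟨pairComplement Sum.inl (Sum.inr ∘ Fin.castLE h), ?_, ?_⟩
  · simpa using rank_pairComplement (Sum.inl_injective)
      (Sum.inr_injective.comp (Fin.castLE_injective h)) (by simp)
  · rw [offDiagonal_eq_pairMatrix h]
    exact det_pairMatrix_add_pairComplement_ne_zero (Sum.inl_injective)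
      (Sum.inr_injective.comp (Fin.castLE_injective h)) (by simp) one_ne_zero (by simp)

theorem rank_imaginaryBlocks_add_le {n : ℕ} (x : Fin (n / 2) → ℝ) :
    (imaginaryBlocks n x).rank + 2 * zeroMult x ≤ 2 * (n / 2) := by
  rw [imaginaryBlocks_eq_pairMatrix]
  exact rank_pairMatrix_add_le x

theorem rank_imaginaryBlocks_sub_add_le {n : ℕ} (x : Fin (n / 2) → ℝ) {b : ℝ} (hb : b ≠ 0) :
    (imaginaryBlocks n x - (b : ℂ) • 1).rank + {j | |x j| = |b|}.ncard ≤ n := by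
  rw [imaginaryBlocks_eq_pairMatrix]
  refine (rank_pairMatrix_sub_add_le ?_ ?_ ?_ Complex.I_ne_zero x hb).trans (by simp)
  · intro i j; simp [Fin.ext_iff]
  · intro i j; simp [Fin.ext_iff]
  · intro i j; simp [Fin.ext_iff]; omega

theorem exists_imaginaryBlocks_complement (n : ℕ) :
    ∃ E : Matrix (Fin n) (Fin n) ℂ, E.rank + 2 * (n / 2) = n ∧
      ∀ x : Fin (n / 2) → ℝ, (∀ k, x k * x k = 1) → (imaginaryBlocks n x + E).det ≠ 0 := by
  let u : Fin (n / 2) → Fin n := fun k => ⟨2 * (k : ℕ), by omega⟩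
  let v : Fin (n / 2) → Fin n := fun k => ⟨2 * (k : ℕ) + 1, by omega⟩
  have hu : u.Injective := fun i j => by simp [u, Fin.ext_iff]
  have hv : v.Injective := fun i j => by simp [v, Fin.ext_iff]
  have huv : ∀ i j, u i ≠ v j := fun i j => by simp [u, v, Fin.ext_iff]; omega
  refine ⟨pairComplement u v, by simpa using rank_pairComplement hu hv huv, fun x hx => ?_⟩
  rw [imaginaryBlocks_eq_pairMatrix]
  exact det_pairMatrix_add_pairComplement_ne_zero hu hv huv Complex.I_ne_zero hx

theorem exists_sum_eq_zero_forall_ne_zero {n : ℕ} (hn : 2 ≤ n) :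
    ∃ x : Fin n → ℝ, ∑ i, x i = 0 ∧ ∀ i, x i ≠ 0 := by
  obtain ⟨m, rfl⟩ : ∃ m, n = m + 2 := ⟨n - 2, by omega⟩
  refine ⟨Fin.cons (-(m + 1 : ℝ)) fun _ => 1, ?_, fun i => ?_⟩
  · simp [Fin.sum_univ_succ]
  · refine Fin.cases ?_ (fun i => ?_) i
    · simp only [Fin.cons_zero]
      have : (0 : ℝ) < m + 1 := by positivity
      linarith
    · simp

theorem rank_fromBlocks_sub_smul_one_le {m n : Type*} [Fintype m] [Fintype n] [DecidableEq m]
    [DecidableEq n] (A : Matrix m m ℂ) (B : Matrix n n ℂ) (b : ℂ) :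
    (fromBlocks A 0 0 B - b • 1).rank ≤ (A - b • 1).rank + (B - b • 1).rank := by
  rw [fromBlocks_sub_smul_one]
  exact rank_fromBlocks_diagonal_le _ _

theorem det_realDiagonal_ne_zero {n : ℕ} {x : Fin n → ℝ} (hx : ∀ i, x i ≠ 0) :
    (realDiagonal x).det ≠ 0 := by
  simp [realDiagonal, det_diagonal, Finset.prod_ne_zero_iff, hx]

theorem trace_realDiagonal {n : ℕ} (x : Fin n → ℝ) :
    (realDiagonal x).trace = ((∑ i, x i : ℝ) : ℂ) := by
  simp [realDiagonal, trace_diagonal]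

theorem trace_fromBlocks_diagonal {m n : Type*} [Fintype m] [Fintype n]
    (A : Matrix m m ℂ) (B : Matrix n n ℂ) : (fromBlocks A 0 0 B).trace = A.trace + B.trace := by
  simp [trace, Fintype.sum_sum_type]

theorem zeroMult_neg {r : ℕ} (x : Fin r → ℝ) : zeroMult (-x) = zeroMult x := by
  simp [zeroMult]

theorem torus_AI_mem {n : ℕ} {x : Fin n → ℝ} (hx : ∑ i, x i = 0) :
    (AI n).torus x ∈ (AI n).forms.𝔭 := by
  refine ⟨⟨(trace_realDiagonal x).trans (by simp [hx]), by rintro _ ⟨⟩, by rintro _ ⟨⟩, ?_⟩,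
    realDiagonal_conjTranspose x⟩
  rintro C rfl
  change realDiagonal x * (1 : Matrix (Fin n) (Fin n) ℂ) = (1 : Matrix (Fin n) (Fin n) ℂ) * (realDiagonal x).map star
  rw [realDiagonal_map_star, mul_one, one_mul]

theorem torus_AII_mem {n : ℕ} {x : Fin n → ℝ} (hx : ∑ i, x i = 0) :
    (AII n).torus x ∈ (AII n).forms.𝔭 := by
  refine ⟨⟨(trace_fromBlocks_diagonal _ _).trans (by simp [trace_realDiagonal, hx]),
    by rintro _ ⟨⟩, by rintro _ ⟨⟩, ?_⟩, ?_⟩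
  · rintro C rfl
    change fromBlocks (realDiagonal x) 0 0 (realDiagonal x) * Matrix.J (Fin n) ℂ
      = Matrix.J (Fin n) ℂ * (fromBlocks (realDiagonal x) 0 0 (realDiagonal x)).map star
    rw [fromBlocks_map, realDiagonal_map_star]
    simp [Matrix.J, fromBlocks_multiply]
  · change (fromBlocks (realDiagonal x) 0 0 (realDiagonal x))ᴴ = fromBlocks (realDiagonal x) 0 0 (realDiagonal x)
    rw [fromBlocks_conjTranspose, realDiagonal_conjTranspose]
    simp

theorem torus_AIII_mem {p q : ℕ} (x : Fin p → ℝ) :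
    (AIII p q).torus x ∈ (AIII p q).forms.𝔭 := by
  refine ⟨⟨trace_offDiagonal x, by rintro _ ⟨⟩, ?_, by rintro _ ⟨⟩⟩, offDiagonal_conjTranspose x⟩
  rintro H rfl
  change (offDiagonal q x)ᴴ * signature p q + signature p q * offDiagonal q x = 0
  rw [offDiagonal_conjTranspose, offDiagonal_mul_signature]

theorem torus_BDI_mem {p q : ℕ} (x : Fin p → ℝ) :
    (BDI p q).torus x ∈ (BDI p q).forms.𝔭 := by
  refine ⟨⟨trace_offDiagonal x, ?_, by rintro _ ⟨⟩, ?_⟩, offDiagonal_conjTranspose x⟩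
  · rintro H rfl
    change (offDiagonal q x)ᵀ * signature p q + signature p q * offDiagonal q x = 0
    rw [offDiagonal_transpose, offDiagonal_mul_signature]
  · rintro C rfl
    change offDiagonal q x * (1 : Matrix (Fin p ⊕ Fin q) (Fin p ⊕ Fin q) ℂ)
      = (1 : Matrix (Fin p ⊕ Fin q) (Fin p ⊕ Fin q) ℂ) * (offDiagonal q x).map star
    rw [offDiagonal_map_star, mul_one, one_mul]

theorem torus_CI_mem {n : ℕ} (x : Fin n → ℝ) : (CI n).torus x ∈ (CI n).forms.𝔭 := by
  have htr : (fromBlocks (realDiagonal x) 0 0 (-realDiagonal x)).trace = 0 := by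
    simp [trace_fromBlocks_diagonal]
  refine ⟨⟨htr, ?_, by rintro _ ⟨⟩, ?_⟩, ?_⟩
  · rintro H rfl
    change (fromBlocks (realDiagonal x) 0 0 (-realDiagonal x))ᵀ * Matrix.J (Fin n) ℂ
      + Matrix.J (Fin n) ℂ * fromBlocks (realDiagonal x) 0 0 (-realDiagonal x) = 0
    rw [fromBlocks_transpose, transpose_neg, realDiagonal_transpose]
    simp [Matrix.J, fromBlocks_multiply, fromBlocks_add]
  · rintro C rfl
    change fromBlocks (realDiagonal x) 0 0 (-realDiagonal x) * (1 : Matrix (Fin n ⊕ Fin n) (Fin n ⊕ Fin n) ℂ)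
      = (1 : Matrix (Fin n ⊕ Fin n) (Fin n ⊕ Fin n) ℂ) * (fromBlocks (realDiagonal x) 0 0 (-realDiagonal x)).map star
    rw [fromBlocks_map, neg_realDiagonal, realDiagonal_map_star, realDiagonal_map_star]
    simp
  · change (fromBlocks (realDiagonal x) 0 0 (-realDiagonal x))ᴴ = fromBlocks (realDiagonal x) 0 0 (-realDiagonal x)
    rw [fromBlocks_conjTranspose, conjTranspose_neg, realDiagonal_conjTranspose]
    simp

theorem torus_CII_mem {p q : ℕ} (x : Fin p → ℝ) :
    (CII p q).torus x ∈ (CII p q).forms.𝔭 := by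
  refine ⟨⟨(trace_fromBlocks_diagonal _ _).trans (by simp [trace_offDiagonal]),
    by rintro _ ⟨⟩, ?_, ?_⟩, ?_⟩
  · rintro H rfl
    change (fromBlocks (offDiagonal q x) 0 0 (offDiagonal q x))ᴴ
        * fromBlocks (signature p q) 0 0 (signature p q)
      + fromBlocks (signature p q) 0 0 (signature p q)
        * fromBlocks (offDiagonal q x) 0 0 (offDiagonal q x) = 0
    rw [fromBlocks_conjTranspose, offDiagonal_conjTranspose]
    simp [fromBlocks_multiply, fromBlocks_add, offDiagonal_mul_signature]
  · rintro C rfl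
    change fromBlocks (offDiagonal q x) 0 0 (offDiagonal q x) * Matrix.J (Fin p ⊕ Fin q) ℂ
      = Matrix.J (Fin p ⊕ Fin q) ℂ * (fromBlocks (offDiagonal q x) 0 0 (offDiagonal q x)).map star
    rw [fromBlocks_map, offDiagonal_map_star]
    simp [Matrix.J, fromBlocks_multiply]
  · change (fromBlocks (offDiagonal q x) 0 0 (offDiagonal q x))ᴴ = fromBlocks (offDiagonal q x) 0 0 (offDiagonal q x)
    rw [fromBlocks_conjTranspose, offDiagonal_conjTranspose]
    simp

theorem torus_DIII_mem {n : ℕ} (x : Fin (n / 2) → ℝ) :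
    (DIII n).torus x ∈ (DIII n).forms.𝔭 := by
  have htr : (fromBlocks (imaginaryBlocks n x) 0 0 (-imaginaryBlocks n x)).trace = 0 := by
    simp [trace_fromBlocks_diagonal]
  refine ⟨⟨htr, ?_, ?_, by rintro _ ⟨⟩⟩, ?_⟩
  · rintro H rfl
    change (fromBlocks (imaginaryBlocks n x) 0 0 (-imaginaryBlocks n x))ᵀ * (1 : Matrix (Fin n ⊕ Fin n) (Fin n ⊕ Fin n) ℂ)
      + (1 : Matrix (Fin n ⊕ Fin n) (Fin n ⊕ Fin n) ℂ) * fromBlocks (imaginaryBlocks n x) 0 0 (-imaginaryBlocks n x) = 0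
    rw [fromBlocks_transpose, transpose_neg, imaginaryBlocks_transpose]
    simp [fromBlocks_add]
  · rintro H rfl
    change (fromBlocks (imaginaryBlocks n x) 0 0 (-imaginaryBlocks n x))ᴴ * Matrix.J (Fin n) ℂ
      + Matrix.J (Fin n) ℂ * fromBlocks (imaginaryBlocks n x) 0 0 (-imaginaryBlocks n x) = 0
    rw [fromBlocks_conjTranspose, conjTranspose_neg, imaginaryBlocks_conjTranspose]
    simp [Matrix.J, fromBlocks_multiply, fromBlocks_add]
  · change (fromBlocks (imaginaryBlocks n x) 0 0 (-imaginaryBlocks n x))ᴴ = fromBlocks (imaginaryBlocks n x) 0 0 (-imaginaryBlocks n x)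
    rw [fromBlocks_conjTranspose, conjTranspose_neg, imaginaryBlocks_conjTranspose]
    simp

section Singular

variable {L : ℕ}

theorem singular_AI {n : ℕ} (hn : 2 ≤ n) (X : Fin L → (AI n).forms.𝔭) (x : Fin L → Fin n → ℝ)
    (hX : ∀ i, (X i : Matrix (AI n).Idx (AI n).Idx ℂ) = (AI n).torus (x i))
    (hne : ¬ ∑ i, (S .A (x i) : ℤ) ≤ ((L : ℤ) - 1) * n) :
    (AI n).forms.orbitalConvolution X ⟂ₘ (AI n).forms.lebesgue := by
  obtain ⟨y, hy, hy0⟩ := exists_sum_eq_zero_forall_ne_zero hn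
  have hcard : Fintype.card (Fin n) = 1 * n := by simp
  have h1 (x : Fin n → ℝ) (b : ℝ) :
      (realDiagonal x - (b : ℂ) • 1).rank + 1 * {j | x j = b}.ncard ≤ 1 * n := by
    rw [one_mul, one_mul]
    exact (rank_realDiagonal_sub_add x b).le
  exact FormData.mutuallySingular_of_not_eligible_typeA (r := n) _ le_rfl (by omega)
    (AI n).torus hcard h1 _ (torus_AI_mem hy) (det_realDiagonal_ne_zero hy0) X x hX hne

theorem singular_AII {n : ℕ} (hn : 2 ≤ n) (X : Fin L → (AII n).forms.𝔭) (x : Fin L → Fin n → ℝ)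
    (hX : ∀ i, (X i : Matrix (AII n).Idx (AII n).Idx ℂ) = (AII n).torus (x i))
    (hne : ¬ ∑ i, (S .A (x i) : ℤ) ≤ ((L : ℤ) - 1) * n) :
    (AII n).forms.orbitalConvolution X ⟂ₘ (AII n).forms.lebesgue := by
  obtain ⟨y, hy, hy0⟩ := exists_sum_eq_zero_forall_ne_zero hn
  have hcard : Fintype.card (Fin n ⊕ Fin n) = 2 * n := by simp; ring
  have hdet : (fromBlocks (realDiagonal y) 0 0 (realDiagonal y)).det ≠ 0 := by
    rw [det_fromBlocks_zero₂₁]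
    exact mul_ne_zero (det_realDiagonal_ne_zero hy0) (det_realDiagonal_ne_zero hy0)
  have h1 (x : Fin n → ℝ) (b : ℝ) :
      (fromBlocks (realDiagonal x) 0 0 (realDiagonal x) - (b : ℂ) • 1).rank
        + 2 * {j | x j = b}.ncard ≤ 2 * n := by
    have h := rank_fromBlocks_sub_smul_one_le (realDiagonal x) (realDiagonal x) b
    have h' := rank_realDiagonal_sub_add x b
    omega
  exact FormData.mutuallySingular_of_not_eligible_typeA (r := n) _ one_le_two (by omega)
    (AII n).torus hcard h1 _ (torus_AII_mem hy) hdet X x hX hne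

theorem singular_AIII {p q : ℕ} (hpq : p ≤ q) (X : Fin L → (AIII p q).forms.𝔭)
    (x : Fin L → Fin p → ℝ)
    (hX : ∀ i, (X i : Matrix (AIII p q).Idx (AIII p q).Idx ℂ) = (AIII p q).torus (x i))
    (hne : ¬ ∑ i, (S .C (x i) : ℤ) ≤ ((L : ℤ) - 1) * (2 * p)) :
    (AIII p q).forms.orbitalConvolution X ⟂ₘ (AIII p q).forms.lebesgue := by
  have hcard : Fintype.card (Fin p ⊕ Fin q) = 1 * (2 * p) + (q - p) := by simp; omega
  obtain ⟨E, hE, hdet⟩ := exists_offDiagonal_complement hpq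
  have h0 (x : Fin p → ℝ) : (offDiagonal q x).rank + 1 * (2 * zeroMult x) ≤ 1 * (2 * p) := by
    rw [one_mul, one_mul]
    exact rank_offDiagonal_add_le hpq x
  have h1 (x : Fin p → ℝ) (b : ℝ) (hb : b ≠ 0) :
      (offDiagonal q x - (b : ℂ) • 1).rank + 1 * {j | |x j| = |b|}.ncard
        ≤ Fintype.card (Fin p ⊕ Fin q) := by
    rw [one_mul]
    simpa using rank_offDiagonal_sub_add_le hpq x hb
  exact FormData.mutuallySingular_of_not_eligible (r := p) _ le_rfl (AIII p q).torus hcard h0 h1 _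
    (torus_AIII_mem fun _ => 1) E (show E.rank ≤ _ by omega) hdet X x hX hne

theorem singular_BDI {p q : ℕ} (hpq : p ≤ q) (X : Fin L → (BDI p q).forms.𝔭)
    (x : Fin L → Fin p → ℝ)
    (hX : ∀ i, (X i : Matrix (BDI p q).Idx (BDI p q).Idx ℂ) = (BDI p q).torus (x i))
    (hne : ¬ ∑ i, (S .C (x i) : ℤ) ≤ ((L : ℤ) - 1) * (2 * p)) :
    (BDI p q).forms.orbitalConvolution X ⟂ₘ (BDI p q).forms.lebesgue := by
  have hcard : Fintype.card (Fin p ⊕ Fin q) = 1 * (2 * p) + (q - p) := by simp; omega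
  obtain ⟨E, hE, hdet⟩ := exists_offDiagonal_complement hpq
  have h0 (x : Fin p → ℝ) : (offDiagonal q x).rank + 1 * (2 * zeroMult x) ≤ 1 * (2 * p) := by
    rw [one_mul, one_mul]
    exact rank_offDiagonal_add_le hpq x
  have h1 (x : Fin p → ℝ) (b : ℝ) (hb : b ≠ 0) :
      (offDiagonal q x - (b : ℂ) • 1).rank + 1 * {j | |x j| = |b|}.ncard
        ≤ Fintype.card (Fin p ⊕ Fin q) := by
    rw [one_mul]
    simpa using rank_offDiagonal_sub_add_le hpq x hb
  exact FormData.mutuallySingular_of_not_eligible (r := p) _ le_rfl (BDI p q).torus hcard h0 h1 _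
    (torus_BDI_mem fun _ => 1) E (show E.rank ≤ _ by omega) hdet X x hX hne

theorem ncard_abs_eq {n : ℕ} (x : Fin n → ℝ) {b : ℝ} (hb : b ≠ 0) :
    {j | |x j| = |b|}.ncard = {j | x j = b}.ncard + {j | (-x) j = b}.ncard := by
  rw [← Set.ncard_union_eq]
  · congr 1
    ext j
    simp [abs_eq_abs, neg_eq_iff_eq_neg]
  · refine Set.disjoint_left.2 fun j hj hj' => hb ?_
    have h1 : x j = b := hj
    have h2 : -x j = b := hj'
    linarith

theorem singular_CI {n : ℕ} (X : Fin L → (CI n).forms.𝔭) (x : Fin L → Fin n → ℝ)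
    (hX : ∀ i, (X i : Matrix (CI n).Idx (CI n).Idx ℂ) = (CI n).torus (x i))
    (hne : ¬ ∑ i, (S .C (x i) : ℤ) ≤ ((L : ℤ) - 1) * (2 * n)) :
    (CI n).forms.orbitalConvolution X ⟂ₘ (CI n).forms.lebesgue := by
  have hcard : Fintype.card (Fin n ⊕ Fin n) = 1 * (2 * n) + 0 := by simp; ring
  have hrank (x : Fin n → ℝ) (b : ℝ) :
      (fromBlocks (realDiagonal x) 0 0 (-realDiagonal x) - (b : ℂ) • 1).rank
        + {j | x j = b}.ncard + {j | (-x) j = b}.ncard ≤ 2 * n := by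
    rw [neg_realDiagonal]
    have h := rank_fromBlocks_sub_smul_one_le (realDiagonal x) (realDiagonal (-x)) b
    have h' := rank_realDiagonal_sub_add x b
    have h'' := rank_realDiagonal_sub_add (-x) b
    omega
  have h0 (x : Fin n → ℝ) : (fromBlocks (realDiagonal x) 0 0 (-realDiagonal x)).rank
      + 1 * (2 * zeroMult x) ≤ 1 * (2 * n) := by
    have h := hrank x 0
    have h1 : {j | x j = 0}.ncard = zeroMult x := rfl
    have h2 : {j | (-x) j = 0}.ncard = zeroMult x := zeroMult_neg x
    rw [h1, h2, Complex.ofReal_zero, zero_smul, sub_zero] at h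
    omega
  have h1 (x : Fin n → ℝ) (b : ℝ) (hb : b ≠ 0) :
      (fromBlocks (realDiagonal x) 0 0 (-realDiagonal x) - (b : ℂ) • 1).rank
        + 1 * {j | |x j| = |b|}.ncard ≤ Fintype.card (Fin n ⊕ Fin n) := by
    have h := hrank x b
    rw [ncard_abs_eq x hb]
    omega
  have hdet : (fromBlocks (realDiagonal fun _ : Fin n => 1) 0 0
      (-realDiagonal fun _ : Fin n => 1) + 0).det ≠ 0 := by
    rw [add_zero, det_fromBlocks_zero₂₁, neg_realDiagonal]
    exact mul_ne_zero (det_realDiagonal_ne_zero (by simp)) (det_realDiagonal_ne_zero (by simp))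
  exact FormData.mutuallySingular_of_not_eligible (r := n) _ le_rfl (CI n).torus hcard h0 h1 _
    (torus_CI_mem fun _ => 1) 0 rank_zero.le hdet X x hX hne

theorem singular_CII {p q : ℕ} (hpq : p ≤ q) (X : Fin L → (CII p q).forms.𝔭)
    (x : Fin L → Fin p → ℝ)
    (hX : ∀ i, (X i : Matrix (CII p q).Idx (CII p q).Idx ℂ) = (CII p q).torus (x i))
    (hne : ¬ ∑ i, (S .C (x i) : ℤ) ≤ ((L : ℤ) - 1) * (2 * p)) :
    (CII p q).forms.orbitalConvolution X ⟂ₘ (CII p q).forms.lebesgue := by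
  have hcard : Fintype.card ((Fin p ⊕ Fin q) ⊕ (Fin p ⊕ Fin q)) = 2 * (2 * p) + 2 * (q - p) := by
    simp; omega
  obtain ⟨E, hE, hdet⟩ := exists_offDiagonal_complement hpq
  have h0 (x : Fin p → ℝ) : (fromBlocks (offDiagonal q x) 0 0 (offDiagonal q x)).rank
      + 2 * (2 * zeroMult x) ≤ 2 * (2 * p) := by
    have h := rank_fromBlocks_diagonal_le (offDiagonal q x) (offDiagonal q x)
    have h' := rank_offDiagonal_add_le hpq x
    omega
  have h1 (x : Fin p → ℝ) (b : ℝ) (hb : b ≠ 0) :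
      (fromBlocks (offDiagonal q x) 0 0 (offDiagonal q x) - (b : ℂ) • 1).rank
        + 2 * {j | |x j| = |b|}.ncard ≤ Fintype.card ((Fin p ⊕ Fin q) ⊕ (Fin p ⊕ Fin q)) := by
    have h := rank_fromBlocks_sub_smul_one_le (offDiagonal q x) (offDiagonal q x) b
    have h' := rank_offDiagonal_sub_add_le hpq x hb
    omega
  have hE' := rank_fromBlocks_diagonal_le E E
  have hdet' : (fromBlocks (offDiagonal q fun _ : Fin p => 1) 0 0 (offDiagonal q fun _ => 1)
      + fromBlocks E 0 0 E).det ≠ 0 := by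
    rw [fromBlocks_add, add_zero, det_fromBlocks_zero₂₁]
    exact mul_ne_zero hdet hdet
  exact FormData.mutuallySingular_of_not_eligible (r := p) _ one_le_two (CII p q).torus hcard h0 h1
    _ (torus_CII_mem fun _ => 1) (fromBlocks E 0 0 E)
    (show (fromBlocks E 0 0 E).rank ≤ _ by omega) hdet' X x hX hne

theorem singular_DIII {n : ℕ} (X : Fin L → (DIII n).forms.𝔭) (x : Fin L → Fin (n / 2) → ℝ)
    (hX : ∀ i, (X i : Matrix (DIII n).Idx (DIII n).Idx ℂ) = (DIII n).torus (x i))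
    (hne : ¬ ∑ i, (S .C (x i) : ℤ) ≤ ((L : ℤ) - 1) * (2 * (n / 2 : ℕ))) :
    (DIII n).forms.orbitalConvolution X ⟂ₘ (DIII n).forms.lebesgue := by
  have hcard : Fintype.card (Fin n ⊕ Fin n) = 2 * (2 * (n / 2)) + 2 * (n - 2 * (n / 2)) := by
    simp; omega
  obtain ⟨E, hE, hdet⟩ := exists_imaginaryBlocks_complement n
  have h0 (x : Fin (n / 2) → ℝ) :
      (fromBlocks (imaginaryBlocks n x) 0 0 (-imaginaryBlocks n x)).rank
        + 2 * (2 * zeroMult x) ≤ 2 * (2 * (n / 2)) := by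
    have h := rank_fromBlocks_diagonal_le (imaginaryBlocks n x) (imaginaryBlocks n (-x))
    have h' := rank_imaginaryBlocks_add_le x
    have h'' := rank_imaginaryBlocks_add_le (-x)
    rw [zeroMult_neg] at h''
    rw [← imaginaryBlocks_neg]
    omega
  have h1 (x : Fin (n / 2) → ℝ) (b : ℝ) (hb : b ≠ 0) :
      (fromBlocks (imaginaryBlocks n x) 0 0 (-imaginaryBlocks n x) - (b : ℂ) • 1).rank
        + 2 * {j | |x j| = |b|}.ncard ≤ Fintype.card (Fin n ⊕ Fin n) := by
    have h := rank_fromBlocks_sub_smul_one_le (imaginaryBlocks n x) (imaginaryBlocks n (-x)) b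
    have h' := rank_imaginaryBlocks_sub_add_le x hb
    have h'' := rank_imaginaryBlocks_sub_add_le (-x) hb
    simp only [Pi.neg_apply, abs_neg] at h''
    rw [← imaginaryBlocks_neg]
    omega
  have hE' := rank_fromBlocks_diagonal_le E E
  have hdet' : (fromBlocks (imaginaryBlocks n fun _ => 1) 0 0 (-imaginaryBlocks n fun _ => 1)
      + fromBlocks E 0 0 E).det ≠ 0 := by
    rw [fromBlocks_add, add_zero, det_fromBlocks_zero₂₁, ← imaginaryBlocks_neg]
    exact mul_ne_zero (hdet _ (by simp)) (hdet _ (by simp))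
  exact FormData.mutuallySingular_of_not_eligible (r := n / 2) _ one_le_two (DIII n).torus hcard
    h0 h1 _ (torus_DIII_mem fun _ => 1) (fromBlocks E 0 0 E)
    (show (fromBlocks E 0 0 E).rank ≤ _ by omega) hdet' X x hX hne

end Singular

end CartanClass

theorem mainTheorem9 (c : CartanClass) (hc : c.Admissible) (L : ℕ) (hL : 1 ≤ L)
    (X : Fin L → c.forms.𝔭) (x : Fin L → Fin c.dim → ℝ)
    (hX : ∀ i, (X i : Matrix c.Idx c.Idx ℂ) = c.torus (x i))
    (hne : ¬ RootType.Eligible c.rootType x) :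
    c.forms.orbitalConvolution X ⟂ₘ c.forms.lebesgue := by
  have hstd {t : RootType} (ht : t ≠ .A) {r : ℕ} {x : Fin L → Fin r → ℝ}
      (h : ¬ RootType.Eligible t x) :
      ¬ ∑ i, (RootType.S .C (x i) : ℤ) ≤ ((L : ℤ) - 1) * (2 * r) := by
    cases t
    · exact absurd rfl ht
    all_goals exact h
  cases c with
  | AI n => exact CartanClass.singular_AI hc X x hX hne
  | AII n => exact CartanClass.singular_AII hc X x hX hne
  | AIII p q =>
    refine CartanClass.singular_AIII hc.2 X x hX (hstd ?_ hne)
    simp only [CartanClass.rootType]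
    split_ifs <;> simp
  | BDI p q =>
    refine CartanClass.singular_BDI hc.2.1 X x hX (hstd ?_ hne)
    simp only [CartanClass.rootType]
    split_ifs <;> simp
  | CI n => exact CartanClass.singular_CI X x hX (hstd (by simp [CartanClass.rootType]) hne)
  | CII p q =>
    refine CartanClass.singular_CII hc.2 X x hX (hstd ?_ hne)
    simp only [CartanClass.rootType]
    split_ifs <;> simp
  | DIII n =>
    refine CartanClass.singular_DIII X x hX (hstd ?_ hne)
    simp only [CartanClass.rootType]
    split_ifs <;> simp
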